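/- Let $\kappa>0$ and let $\{X_n\}_{n\ge 0}$ be independent, identically distributed real random variables with mean $0$ and variance $\kappa$ on a probability space $(\Omega,\mathcal F,P)$. Put $X_n'=X_n/\sqrt{\kappa}$. For $x\in\mathbb R\setminus\{0\}$ let $\{Y_m\}_{m\ge 0}$ be the Markov chain defined by $Y_0=x$ and \[ Y_m=\sqrt{(Y_{m-1}-X_m')^2+\frac4\kappa},\qquad m\ge 1 \] (nonnegative square root). Call the chain transient if for every starting point $x\neq 0$ one has $Y_m\to\infty$ almost surely, and recurrent if there is a finite $r$ such that for every starting point $x\ne 0$, almost surely $|Y_m|\le r$ for infinitely many $m$. Then: 1. if $\kappa<4$, the chain is transient; 2. if $\kappa>4$, the chain is recurrent; 3. if $\kappa=4$ and the moment generating function of $X_1'$ has a positive radius of convergence, i.e. $\mathbb E[e^{tX_1'}]<\infty$ for all real $t$ in some neighbourhood of $0$, the chain is recurrent. -/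

import Mathlib

/-- The discrete Bessel-type chain driven by the real sequence `ξ` and started at `x`:
`Y 0 = x` and `Y m = √((Y (m - 1) - ξ m) ^ 2 + 4 / κ)` for `m ≥ 1`. -/
noncomputable def besselChain (κ : ℝ) (ξ : ℕ → ℝ) (x : ℝ) : ℕ → ℝ
  | 0 => x
  | m + 1 => Real.sqrt ((besselChain κ ξ x m - ξ (m + 1)) ^ 2 + 4 / κ)

/-- `Y x m` is the position at time `m` of the real-valued chain started at `x`, where the
starting points are the nonzero reals. The chain is transient if, from every starting point,
it almost surely tends to infinity. -/
def IsTransientChain {Ω : Type*} [MeasurableSpace Ω] (P : MeasureTheory.Measure Ω)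
    (Y : ℝ → ℕ → Ω → ℝ) : Prop :=
  ∀ x : ℝ, x ≠ 0 → ∀ᵐ ω ∂P, Filter.Tendsto (fun m => |Y x m ω|) Filter.atTop Filter.atTop

/-- The chain is recurrent if there is one bounded set which, from every starting point,
is almost surely visited infinitely often. -/
def IsRecurrentChain {Ω : Type*} [MeasurableSpace Ω] (P : MeasureTheory.Measure Ω)
    (Y : ℝ → ℕ → Ω → ℝ) : Prop :=
  ∃ r : ℝ, ∀ x : ℝ, x ≠ 0 → ∀ᵐ ω ∂P, ∃ᶠ m in Filter.atTop, |Y x m ω| ≤ r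

/-- The moment generating function `t ↦ E[exp (t Z)]` of `Z` has a positive radius of
convergence: it is finite in a neighbourhood of `0`. -/
def HasPosMgfRadius {Ω : Type*} [MeasurableSpace Ω] (P : MeasureTheory.Measure Ω)
    (Z : Ω → ℝ) : Prop :=
  ∃ ρ : ℝ, 0 < ρ ∧ ∀ t : ℝ, |t| < ρ →
    MeasureTheory.Integrable (fun ω => Real.exp (t * Z ω)) P

/-! Put c = 4/κ. A step e, of mean 0 and variance 1, sends z = y² to (y - e)² + c, so to second
order log z has mean increment (c - 1)/y². This is the behaviour of a Bessel process of dimension 1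
+ c, and the sign changes at κ = 4. Each regime uses a Lyapunov function φ(z): a nonnegative
supermartingale converges almost surely, while the chain is almost surely unbounded because long
runs of negative steps keep recurring. If φ tends to infinity, convergence is impossible on the
event of staying outside a bounded set. If φ decreases to 0, its limit along the chain must be 0, so
the chain tends to infinity.

For κ > 4, φ = log z - log c works with two moments only, since `Real.log_le_sub_one_of_pos`
controls the long jumps (`exists_log_drift`). For κ = 4 the leading terms cancel. The concavity of √
in φ = √(log z) leaves -1/(2y²(log y²)^(3/2)), which beats an O(y⁻³) error; this error is where
higher moments enter (`exists_sqrt_log_drift`).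

For κ < 4, (b/(b + z))^ε has a negative mean drift from moderate steps, but jumps with |e| > εy can
cost P(|e| > εy), which two moments do not make small enough against that drift. The remedy is to
average over scales b(ζ) ≥ ζ²/ε² with ζ distributed as a step, and with weight at least ζ²/ε² in the
tail. The scales with |ζ| > εy then gain a fixed multiple of P(|e| > εy), and the total weight is
small enough for this to cover the loss (`exists_bounded_drift`). -/

open MeasureTheory ProbabilityTheory Filter Topology

/-! ### Conditioning on the past, and supermartingale convergence -/

section Freezing

variable {Ω : Type*} {m mΩ : MeasurableSpace Ω} {P : Measure Ω}

/-- Freezing an independent variable: if the average of `T y` over the law of `ξ` is at most `V y`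
for the values `y` taken by `U` on `s`, then the integral over `s` of `T U ξ` is at most that
of `V U`. -/
theorem setIntegral_comp_le_of_indep [IsProbabilityMeasure P] (hm : m ≤ mΩ) {U ξ : Ω → ℝ}
    (hU : Measurable[m] U) (hξ : Measurable ξ)
    (hind : Indep (MeasurableSpace.comap ξ inferInstance) m P) {s : Set Ω}
    (hs : MeasurableSet[m] s) {T : ℝ × ℝ → ℝ} (hT : Measurable T) {V : ℝ → ℝ}
    (hTi : IntegrableOn (fun ω => T (U ω, ξ ω)) s P)
    (hVi : IntegrableOn (fun ω => V (U ω)) s P)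
    (hle : ∀ ω ∈ s, ∫ e, T (U ω, e) ∂(P.map ξ) ≤ V (U ω)) :
    ∫ ω in s, T (U ω, ξ ω) ∂P ≤ ∫ ω in s, V (U ω) ∂P := by
  have hU' : Measurable U := hU.mono hm le_rfl
  have hprob : IsProbabilityMeasure (P.map ξ) := Measure.isProbabilityMeasure_map hξ.aemeasurable
  -- Both U and s are measurable for `m`, so ξ stays independent of U under the restriction to s.
  have hprod : ((P.restrict s).map U).prod (P.map ξ) =
      (P.restrict s).map (fun ω => (U ω, ξ ω)) := by
    refine Measure.prod_eq fun A B hA hB => ?_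
    rw [Measure.map_apply (hU'.prodMk hξ) (hA.prod hB), Measure.map_apply hU' hA,
      Measure.map_apply hξ hB, Measure.restrict_apply (hU' hA),
      Measure.restrict_apply ((hU'.prodMk hξ) (hA.prod hB))]
    have h := (Indep_iff _ _ _).1 hind _ _ ⟨B, hB, rfl⟩ ((hU hA).inter hs)
    rw [mul_comm, ← h]
    congr 1
    ext ω
    simp only [Set.mem_inter_iff, Set.mem_preimage, Set.mem_prod]
    tauto
  have hTi' : Integrable T (((P.restrict s).map U).prod (P.map ξ)) := by
    rw [hprod]
    exact (integrable_map_measure hT.aestronglyMeasurable (hU'.prodMk hξ).aemeasurable).2 hTi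
  have h1 : ∫ ω in s, T (U ω, ξ ω) ∂P = ∫ ω in s, (∫ e, T (U ω, e) ∂(P.map ξ)) ∂P := by
    rw [← integral_map (f := T) (φ := fun ω => (U ω, ξ ω)) (hU'.prodMk hξ).aemeasurable
      hT.aestronglyMeasurable, ← hprod, integral_prod _ hTi']
    exact integral_map hU'.aemeasurable
      (hT.stronglyMeasurable.integral_prod_right' (ν := P.map ξ)).aestronglyMeasurable
  rw [h1]
  refine setIntegral_mono_on ?_ hVi (hm _ hs) hle
  have h2 := hTi'.integral_prod_left
  exact (integrable_map_measure h2.aestronglyMeasurable hU'.aemeasurable).1 h2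

/-- Convergence of nonnegative supermartingales, in terms of set integrals. -/
theorem ae_exists_tendsto_of_setIntegral_succ_le [IsProbabilityMeasure P] {G : Filtration ℕ mΩ}
    {W : ℕ → Ω → ℝ} (hadp : StronglyAdapted G W) (hint : ∀ k, Integrable (W k) P)
    (h0 : ∀ k ω, 0 ≤ W k ω)
    (hstep : ∀ k s, MeasurableSet[G k] s → ∫ ω in s, W (k + 1) ω ∂P ≤ ∫ ω in s, W k ω ∂P) :
    ∀ᵐ ω ∂P, ∃ l, Tendsto (fun k => W k ω) atTop (𝓝 l) := by
  have hsup : Supermartingale W G P := supermartingale_of_setIntegral_succ_le hadp hint hstep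
  have hdec : ∀ k, ∫ ω, W k ω ∂P ≤ ∫ ω, W 0 ω ∂P := by
    intro k
    induction k with
    | zero => exact le_rfl
    | succ k ih => exact le_trans (by simpa using hstep k Set.univ MeasurableSet.univ) ih
  -- By nonnegativity the L¹ norms are the integrals, which decrease; Doob's theorem then applies to
  -- the submartingale -W.
  have hbdd : ∀ k, eLpNorm ((-W) k) 1 P ≤ (Real.toNNReal (∫ ω, W 0 ω ∂P) : NNReal) := by
    intro k
    rw [Pi.neg_apply, eLpNorm_neg, eLpNorm_one_eq_lintegral_enorm,
      ← ofReal_integral_norm_eq_lintegral_enorm (hint k)]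
    refine ENNReal.ofReal_le_ofReal ?_
    simpa [Real.norm_eq_abs, abs_of_nonneg (h0 k _)] using hdec k
  filter_upwards [hsup.neg.exists_ae_tendsto_of_bdd hbdd] with ω ⟨l, hl⟩
  exact ⟨-l, by simpa using hl.neg⟩

end Freezing

/-! ### Path properties of the chain and the two Lyapunov criteria -/

section Chain

theorem besselChain_sq {κ : ℝ} (hκ : 0 < κ) (ξ : ℕ → ℝ) (x : ℝ) (n : ℕ) :
    besselChain κ ξ x (n + 1) ^ 2 = (besselChain κ ξ x n - ξ (n + 1)) ^ 2 + 4 / κ := by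
  rw [besselChain, Real.sq_sqrt (by positivity)]

theorem besselChain_succ_nonneg (κ : ℝ) (ξ : ℕ → ℝ) (x : ℝ) (n : ℕ) :
    0 ≤ besselChain κ ξ x (n + 1) := by
  rw [besselChain]
  exact Real.sqrt_nonneg _

theorem sub_le_besselChain_succ {κ : ℝ} (hκ : 0 < κ) (ξ : ℕ → ℝ) (x : ℝ) (n : ℕ) :
    besselChain κ ξ x n - ξ (n + 1) ≤ besselChain κ ξ x (n + 1) := by
  refine abs_le_of_sq_le_sq' ?_ (besselChain_succ_nonneg κ ξ x n) |>.2
  rw [besselChain_sq hκ]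
  have : 0 < 4 / κ := by positivity
  linarith

/-- Since √(a² + c) ≥ a, every step below -u raises the chain by more than u. Taking k > 0 avoids a
negative starting point. -/
theorem natCast_mul_le_besselChain {κ : ℝ} (hκ : 0 < κ) {ξ : ℕ → ℝ} {x u : ℝ} {k N : ℕ}
    (hk : 0 < k) (h : ∀ i < N, ξ (k + i + 1) < -u) :
    N * u ≤ besselChain κ ξ x (k + N) := by
  induction N with
  | zero =>
    obtain ⟨k, rfl⟩ := Nat.exists_eq_succ_of_ne_zero hk.ne'
    simpa using besselChain_succ_nonneg κ ξ x k
  | succ N ih =>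
    have h1 := ih fun i hi => h i (by omega)
    have h2 := h N (by omega)
    have h3 := sub_le_besselChain_succ hκ ξ x (k + N)
    rw [← add_assoc]
    push_cast
    linarith

variable {Ω : Type*} [mΩ : MeasurableSpace Ω] {P : Measure Ω}

theorem measurable_besselChain_natural {ξ : ℕ → Ω → ℝ} (hξ : ∀ n, StronglyMeasurable (ξ n))
    (κ x : ℝ) (n : ℕ) :
    Measurable[Filtration.natural ξ hξ n] fun ω => besselChain κ (fun i => ξ i ω) x n := by
  induction n with
  | zero => exact measurable_const
  | succ n ih =>
    have h1 : Measurable[Filtration.natural ξ hξ (n + 1)]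
        fun ω => besselChain κ (fun i => ξ i ω) x n :=
      ih.mono ((Filtration.natural ξ hξ).mono n.le_succ) le_rfl
    have h2 : Measurable[Filtration.natural ξ hξ (n + 1)] (ξ (n + 1)) :=
      ((Filtration.stronglyAdapted_natural hξ) (n + 1)).measurable
    exact (((h1.sub h2).pow_const 2).add_const _).sqrt

theorem measurable_besselChain {ξ : ℕ → Ω → ℝ} (hξ : ∀ n, Measurable (ξ n)) (κ x : ℝ) (n : ℕ) :
    Measurable fun ω => besselChain κ (fun i => ξ i ω) x n :=
  (measurable_besselChain_natural (fun n => (hξ n).stronglyMeasurable) κ x n).mono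
    ((Filtration.natural ξ _).le n) le_rfl

theorem integrable_besselChain_sq [IsFiniteMeasure P] {κ : ℝ} (hκ : 0 < κ) {ξ : ℕ → Ω → ℝ}
    (hξ : ∀ n, Measurable (ξ n)) (hsq : ∀ n, Integrable (fun ω => ξ n ω ^ 2) P) (x : ℝ) (n : ℕ) :
    Integrable (fun ω => besselChain κ (fun i => ξ i ω) x n ^ 2) P := by
  induction n with
  | zero => exact integrable_const (μ := P) (x ^ 2)
  | succ n ih =>
    have hg := ((ih.const_mul 2).add ((hsq (n + 1)).const_mul 2)).add
      (integrable_const (μ := P) (4 / κ))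
    refine hg.mono' ((measurable_besselChain hξ κ x _).pow_const 2).aestronglyMeasurable
      (ae_of_all _ fun ω => ?_)
    have : 0 < 4 / κ := by positivity
    rw [Real.norm_of_nonneg (sq_nonneg _), besselChain_sq hκ]
    simp only [Pi.add_apply]
    nlinarith [sq_nonneg (besselChain κ (fun i => ξ i ω) x n + ξ (n + 1) ω)]

/-- For an i.i.d. sequence, runs of a prescribed length in a set of positive probability occur
infinitely often. -/
theorem ae_frequently_run {ξ : ℕ → Ω → ℝ} [IsProbabilityMeasure P]
    (hξ : ∀ n, Measurable (ξ n)) (hind : iIndepFun ξ P) {ν : Measure ℝ}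
    (hν : ∀ n, P.map (ξ n) = ν) {S : Set ℝ} (hS : MeasurableSet S) (hpos : ν S ≠ 0) (N : ℕ) :
    ∀ᵐ ω ∂P, ∃ᶠ j in atTop, ∀ i < N, ξ (j * N + i + 1) ω ∈ S := by
  classical
  -- Disjoint blocks of N indices give independent events of equal positive probability, so the
  -- second Borel–Cantelli lemma applies.
  let I : ℕ → Finset ℕ := fun j => (Finset.range N).image fun i => j * N + i + 1
  let B : ℕ → Set Ω := fun j => ⋂ i ∈ I j, ξ i ⁻¹' S
  have hB : ∀ j, MeasurableSet (B j) := fun j =>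
    Finset.measurableSet_biInter _ fun i _ => hξ i hS
  have hS' : ∀ i, P (ξ i ⁻¹' S) = ν S := fun i => by rw [← hν i, Measure.map_apply (hξ i) hS]
  have hcard : ∀ j, (I j).card = N := fun j => by
    rw [Finset.card_image_of_injective _ (fun a b h => by simpa using h), Finset.card_range]
  have hmeas : ∀ s : Finset ℕ, P (⋂ i ∈ s, ξ i ⁻¹' S) = ν S ^ s.card := fun s => by
    rw [hind.measure_inter_preimage_eq_mul s (sets := fun _ => S) fun _ _ => hS,
      Finset.prod_congr rfl fun i _ => hS' i, Finset.prod_const]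
  have hdisj : Pairwise fun a b => Disjoint (I a) (I b) := by
    intro a b hab
    rw [Finset.disjoint_left]
    intro t ha hb
    simp only [I, Finset.mem_image, Finset.mem_range] at ha hb
    obtain ⟨i, hi, rfl⟩ := ha
    obtain ⟨i', hi', h⟩ := hb
    rcases lt_or_gt_of_ne hab with h' | h'
    · have := Nat.mul_le_mul_right N (Nat.succ_le_of_lt h')
      rw [Nat.succ_mul] at this
      omega
    · have := Nat.mul_le_mul_right N (Nat.succ_le_of_lt h')
      rw [Nat.succ_mul] at this
      omega
  have hindB : iIndepSet B P := by
    rw [iIndepSet_iff_meas_biInter hB]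
    intro s
    have h1 : (⋂ j ∈ s, B j) = ⋂ i ∈ s.biUnion I, ξ i ⁻¹' S := by
      simp only [B]
      rw [Finset.set_biInter_biUnion]
    rw [h1, hmeas, Finset.card_biUnion fun a _ b _ hab => hdisj hab,
      Finset.prod_congr rfl fun j _ => hmeas (I j), Finset.prod_pow_eq_pow_sum]
  have hsum : ∑' j, P (B j) = ⊤ := by
    simp only [B, hmeas, hcard]
    exact ENNReal.tsum_const_eq_top_of_ne_zero (pow_ne_zero N hpos)
  have hlim := measure_limsup_eq_one hB hindB hsum
  have hml : MeasurableSet (limsup B atTop) := MeasurableSet.measurableSet_limsup hB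
  have hae : ∀ᵐ ω ∂P, ω ∈ limsup B atTop := by
    rw [← prob_compl_eq_zero_iff hml] at hlim
    exact hlim
  filter_upwards [hae] with ω hω
  rw [mem_limsup_iff_frequently_mem] at hω
  refine hω.mono fun j hj i hi => ?_
  simp only [B, I, Set.mem_iInter, Finset.mem_image, Finset.mem_range] at hj
  exact hj _ ⟨i, hi, rfl⟩

/-- A run of N > r/u steps below -u lifts the chain above r from any nonnegative position. Countably
many N serve all levels r on one almost sure event. -/
theorem ae_frequently_lt_besselChain [IsProbabilityMeasure P] {κ : ℝ} (hκ : 0 < κ)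
    {ξ : ℕ → Ω → ℝ} (hξ : ∀ n, Measurable (ξ n)) (hind : iIndepFun ξ P) {ν : Measure ℝ}
    (hν : ∀ n, P.map (ξ n) = ν) {u : ℝ} (hu : 0 < u) (hpos : ν (Set.Iio (-u)) ≠ 0) (x : ℝ) :
    ∀ᵐ ω ∂P, ∀ r : ℝ, ∃ᶠ n in atTop, r < besselChain κ (fun i => ξ i ω) x n := by
  have h := ae_all_iff.2 fun N => ae_frequently_run hξ hind hν measurableSet_Iio hpos N
  filter_upwards [h] with ω hω r
  obtain ⟨N, hN⟩ := exists_nat_gt (max r 0 / u)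
  rw [div_lt_iff₀ hu] at hN
  have hN0 : 0 < N := by
    rcases Nat.eq_zero_or_pos N with rfl | h
    · simp at hN
    · exact h
  rw [frequently_atTop]
  intro a
  obtain ⟨j, hj, hrun⟩ := (frequently_atTop.1 (hω N)) (a + 1)
  refine ⟨j * N + N, by nlinarith, ?_⟩
  exact (le_max_left r 0).trans_lt (hN.trans_le
    (natCast_mul_le_besselChain hκ (Nat.mul_pos (by omega) hN0) hrun))

/-- A bounded function decreasing to zero along the chain forces transience. -/
theorem ae_tendsto_besselChain_of_drift [IsProbabilityMeasure P] {κ : ℝ} (hκ : 0 < κ)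
    {ξ : ℕ → Ω → ℝ} (hξ : ∀ n, Measurable (ξ n)) (hind : iIndepFun ξ P) {ν : Measure ℝ}
    (hν : ∀ n, P.map (ξ n) = ν) {x : ℝ}
    (hlim : ∀ᵐ ω ∂P, ∀ r : ℝ, ∃ᶠ n in atTop, r < besselChain κ (fun i => ξ i ω) x n)
    {φ : ℝ → ℝ} (hφm : Measurable φ) (hφpos : ∀ z, 0 ≤ z → 0 < φ z)
    (hφanti : AntitoneOn φ (Set.Ici 0)) (hφlim : Tendsto φ atTop (𝓝 0)) {R : ℝ} (hR : 0 ≤ R)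
    (hdrift : ∀ y, R ≤ y → ∫ e, φ ((y - e) ^ 2 + 4 / κ) ∂ν ≤ φ (y ^ 2)) :
    ∀ᵐ ω ∂P, Tendsto (fun n => besselChain κ (fun i => ξ i ω) x n) atTop atTop := by
  have hc : 0 < 4 / κ := by positivity
  have hprob : IsProbabilityMeasure ν := hν 0 ▸ Measure.isProbabilityMeasure_map (hξ 0).aemeasurable
  have hξ' : ∀ n, StronglyMeasurable (ξ n) := fun n => (hξ n).stronglyMeasurable
  -- Time starts at 1 because the starting point x may be negative.
  let Y : ℕ → Ω → ℝ := fun k ω => besselChain κ (fun i => ξ i ω) x (k + 1)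
  let F := Filtration.natural ξ hξ'
  let G : Filtration ℕ mΩ := ⟨fun k => F (k + 1), fun i j h => F.mono (by omega), fun k => F.le _⟩
  have hYm : ∀ k, Measurable[G k] (Y k) := fun k => measurable_besselChain_natural hξ' κ x (k + 1)
  have hY0 : ∀ k ω, 0 ≤ Y k ω := fun k ω => besselChain_succ_nonneg _ _ _ _
  have hYs : ∀ k ω, Y (k + 1) ω ^ 2 = (Y k ω - ξ (k + 2) ω) ^ 2 + 4 / κ := fun k ω =>
    besselChain_sq hκ _ _ _
  -- Truncation extends the drift inequality to all y ≥ 0: for y ≤ R, ψ already has its maximal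
  -- value at y².
  let ψ : ℝ → ℝ := fun z => min (φ z) (φ (R ^ 2))
  have hψm : Measurable ψ := hφm.min measurable_const
  have hψ0 : ∀ z, 0 ≤ z → 0 < ψ z := fun z hz => lt_min (hφpos z hz) (hφpos _ (sq_nonneg R))
  let W : ℕ → Ω → ℝ := fun k ω => ψ (Y k ω ^ 2)
  have hWm : ∀ k, Measurable[G k] (W k) := fun k => hψm.comp ((hYm k).pow_const 2)
  have hbd : ∀ z, 0 ≤ z → ‖ψ z‖ ≤ φ (R ^ 2) := fun z hz => by
    rw [Real.norm_of_nonneg (hψ0 z hz).le]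
    exact min_le_right _ _
  have hWi : ∀ k, Integrable (W k) P := fun k =>
    Integrable.of_bound ((hWm k).mono (G.le k) le_rfl).aestronglyMeasurable (φ (R ^ 2))
      (ae_of_all _ fun ω => hbd _ (sq_nonneg _))
  have hTm : ∀ f : ℝ → ℝ, Measurable f →
      Measurable fun p : ℝ × ℝ => f ((p.1 - p.2) ^ 2 + 4 / κ) := fun f hf =>
    hf.comp (((measurable_fst.sub measurable_snd).pow_const 2).add_const _)
  have hψdrift : ∀ y, 0 ≤ y → ∫ e, ψ ((y - e) ^ 2 + 4 / κ) ∂ν ≤ ψ (y ^ 2) := by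
    intro y hy
    have hi : Integrable (fun e => ψ ((y - e) ^ 2 + 4 / κ)) ν :=
      Integrable.of_bound ((hTm ψ hψm).comp measurable_prodMk_left).aestronglyMeasurable
        (φ (R ^ 2)) (ae_of_all _ fun e => hbd _ (by positivity))
    rcases le_total R y with h | h
    · have hφy : φ (y ^ 2) ≤ φ (R ^ 2) :=
        hφanti (Set.mem_Ici.2 (sq_nonneg _)) (Set.mem_Ici.2 (sq_nonneg _)) (by gcongr)
      simp only [ψ] at hi ⊢
      rw [min_eq_left hφy]
      refine le_trans (integral_mono hi ?_ fun e => min_le_left _ _) (hdrift y h)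
      refine Integrable.of_bound ((hTm φ hφm).comp measurable_prodMk_left).aestronglyMeasurable
        (φ 0) (ae_of_all _ fun e => ?_)
      have h0 : 0 ≤ (y - e) ^ 2 + 4 / κ := by positivity
      rw [Real.norm_of_nonneg (hφpos _ h0).le]
      exact hφanti (Set.mem_Ici.2 le_rfl) (Set.mem_Ici.2 h0) h0
    · have hφy : φ (R ^ 2) ≤ φ (y ^ 2) :=
        hφanti (Set.mem_Ici.2 (sq_nonneg _)) (Set.mem_Ici.2 (sq_nonneg _)) (by gcongr)
      simp only [ψ] at hi ⊢
      rw [min_eq_right hφy]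
      refine le_trans (integral_mono hi (integrable_const (φ (R ^ 2))) fun e => min_le_right _ _) ?_
      simp
  have hconv : ∀ᵐ ω ∂P, ∃ l, Tendsto (fun k => W k ω) atTop (𝓝 l) := by
    refine ae_exists_tendsto_of_setIntegral_succ_le (G := G)
      (fun k => (hWm k).stronglyMeasurable) hWi (fun k ω => (hψ0 _ (sq_nonneg _)).le) ?_
    intro k s hs
    have heq : W (k + 1) = fun ω => ψ ((Y k ω - ξ (k + 2) ω) ^ 2 + 4 / κ) := by
      funext ω
      simp only [W, hYs]
    rw [heq]
    exact setIntegral_comp_le_of_indep (P := P) (G.le k) (hYm k) (hξ (k + 2))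
      (hind.indep_comap_natural_of_lt hξ' (by omega)) hs (hTm ψ hψm) (V := fun y => ψ (y ^ 2))
      (heq ▸ hWi (k + 1)).integrableOn (hWi k).integrableOn
      (fun ω _ => by rw [hν]; exact hψdrift _ (hY0 k ω))
  filter_upwards [hconv, hlim] with ω ⟨l, hl⟩ hω
  -- Along the times when the chain is large, W is close to 0.
  have hl0 : l = 0 := by
    refine le_antisymm (le_of_forall_gt_imp_ge_of_dense fun a ha => ?_)
      (ge_of_tendsto' hl fun k => (hψ0 _ (sq_nonneg _)).le)
    obtain ⟨z₀, hz₀⟩ := eventually_atTop.1 (hφlim.eventually (gt_mem_nhds ha))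
    refine le_of_tendsto_of_frequently hl ?_
    rw [frequently_atTop]
    intro b
    obtain ⟨n, hn, hlt⟩ := frequently_atTop.1 (hω (max z₀ 1)) (b + 1)
    obtain ⟨n, rfl⟩ : ∃ i, n = i + 1 := ⟨n - 1, by omega⟩
    refine ⟨n, by omega, (min_le_left _ _).trans (hz₀ _ ?_).le⟩
    have h1 := (le_max_left z₀ 1).trans_lt hlt
    have h2 := (le_max_right z₀ 1).trans_lt hlt
    change z₀ ≤ besselChain κ (fun i => ξ i ω) x (n + 1) ^ 2
    nlinarith
  subst hl0
  rw [← tendsto_add_atTop_iff_nat 1, tendsto_atTop]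
  intro r
  filter_upwards [hl.eventually (gt_mem_nhds (lt_min (hψ0 (r ^ 2) (sq_nonneg r))
    (hφpos (R ^ 2) (sq_nonneg R))))] with k hk
  by_contra! hlt
  have h1 : Y k ω ^ 2 ≤ r ^ 2 := pow_le_pow_left₀ (hY0 k ω) hlt.le 2
  have h2 : φ (r ^ 2) ≤ φ (Y k ω ^ 2) :=
    hφanti (Set.mem_Ici.2 (sq_nonneg _)) (Set.mem_Ici.2 (sq_nonneg _)) h1
  have h3 : ψ (r ^ 2) ≤ W k ω := min_le_min_right _ h2
  exact absurd (hk.trans_le (min_le_left _ _)) (not_lt.2 h3)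

/-- A function tending to infinity whose average decreases outside a bounded set forces
recurrence. -/
theorem ae_frequently_le_besselChain_of_drift [IsProbabilityMeasure P] {κ : ℝ} (hκ : 0 < κ)
    {ξ : ℕ → Ω → ℝ} (hξ : ∀ n, Measurable (ξ n)) (hind : iIndepFun ξ P) {ν : Measure ℝ}
    (hν : ∀ n, P.map (ξ n) = ν) (hsq : ∀ n, Integrable (fun ω => ξ n ω ^ 2) P) {x : ℝ}
    (hlim : ∀ᵐ ω ∂P, ∀ r : ℝ, ∃ᶠ n in atTop, r < besselChain κ (fun i => ξ i ω) x n)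
    {φ : ℝ → ℝ} (hφm : Measurable φ) (hφ0 : ∀ z, 4 / κ ≤ z → 0 ≤ φ z)
    {C : ℝ} (hφC : ∀ z, 4 / κ ≤ z → φ z ≤ C + z) (hφlim : Tendsto φ atTop atTop) {R : ℝ}
    (hdrift : ∀ y, R < y → ∫ e, φ ((y - e) ^ 2 + 4 / κ) ∂ν ≤ φ (y ^ 2)) :
    ∀ᵐ ω ∂P, ∃ᶠ n in atTop, |besselChain κ (fun i => ξ i ω) x n| ≤ R := by
  have hc : 0 < 4 / κ := by positivity
  have hξ' : ∀ n, StronglyMeasurable (ξ n) := fun n => (hξ n).stronglyMeasurable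
  -- One visit after every time n gives infinitely many visits.
  suffices H : ∀ n : ℕ, ∀ᵐ ω ∂P, ∃ k, besselChain κ (fun i => ξ i ω) x (k + n + 1) ≤ R by
    filter_upwards [ae_all_iff.2 H] with ω hω
    rw [frequently_atTop]
    intro a
    obtain ⟨k, hk⟩ := hω a
    exact ⟨k + a + 1, by omega, by rwa [abs_of_nonneg (besselChain_succ_nonneg _ _ _ _)]⟩
  intro n
  let Y : ℕ → Ω → ℝ := fun k ω => besselChain κ (fun i => ξ i ω) x (k + n + 1)
  let F := Filtration.natural ξ hξ'
  let G : Filtration ℕ mΩ :=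
    ⟨fun k => F (k + n + 1), fun i j h => F.mono (by omega), fun k => F.le _⟩
  have hYm : ∀ k, Measurable[G k] (Y k) := fun k =>
    measurable_besselChain_natural hξ' κ x (k + n + 1)
  have hYs : ∀ k ω, Y (k + 1) ω ^ 2 = (Y k ω - ξ (k + n + 2) ω) ^ 2 + 4 / κ := fun k ω => by
    have := besselChain_sq hκ (fun i => ξ i ω) x (k + n + 1)
    simp only [Y]
    rw [← this]
    congr 2
    omega
  have hYc : ∀ k ω, 4 / κ ≤ Y k ω ^ 2 := fun k ω => by
    simp only [Y]
    rw [besselChain_sq hκ]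
    linarith [sq_nonneg (besselChain κ (fun i => ξ i ω) x (k + n) - ξ (k + n + 1) ω)]
  let A : ℕ → Set Ω := fun k => {ω | ∀ j ≤ k, R < Y j ω}
  have hAm : ∀ k, MeasurableSet[G k] (A k) := fun k => by
    have : A k = ⋂ j, ⋂ (_ : j ≤ k), Y j ⁻¹' Set.Ioi R := by
      ext ω
      simp [A]
    rw [this]
    exact MeasurableSet.iInter fun j => MeasurableSet.iInter fun hj =>
      G.mono hj _ ((hYm j) measurableSet_Ioi)
  let V : ℕ → Ω → ℝ := fun k ω => φ (Y k ω ^ 2)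
  have hVm : ∀ k, Measurable[G k] (V k) := fun k => hφm.comp ((hYm k).pow_const 2)
  have hV0 : ∀ k ω, 0 ≤ V k ω := fun k ω => hφ0 _ (hYc k ω)
  have hVi : ∀ k, Integrable (V k) P := fun k =>
    Integrable.mono' ((integrable_const C).add (integrable_besselChain_sq hκ hξ hsq x (k + n + 1)))
      ((hVm k).mono (G.le k) le_rfl).aestronglyMeasurable
      (ae_of_all _ fun ω => by
        rw [Real.norm_of_nonneg (hV0 k ω)]
        exact hφC _ (hYc k ω))
  -- The process is killed on reaching [0, R], so drift is needed only above R. Killing can only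
  -- lower the nonnegative V.
  let W : ℕ → Ω → ℝ := fun k => (A k).indicator (V k)
  have hconv : ∀ᵐ ω ∂P, ∃ l, Tendsto (fun k => W k ω) atTop (𝓝 l) := by
    refine ae_exists_tendsto_of_setIntegral_succ_le (G := G)
      (fun k => ((hVm k).indicator (hAm k)).stronglyMeasurable)
      (fun k => (hVi k).indicator (G.le k _ (hAm k)))
      (fun k => Set.indicator_nonneg fun ω _ => hV0 k ω) ?_
    intro k s hs
    have hAs : A (k + 1) ⊆ A k := fun ω' h j hj => h j (le_trans hj k.le_succ)
    have hA' := G.le k _ (hAm k)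
    have heq : V (k + 1) = fun ω => φ ((Y k ω - ξ (k + n + 2) ω) ^ 2 + 4 / κ) := by
      funext ω
      simp only [V, hYs]
    calc ∫ ω in s, W (k + 1) ω ∂P ≤ ∫ ω in s, (A k).indicator (V (k + 1)) ω ∂P := by
          refine integral_mono ((hVi _).indicator (G.le _ _ (hAm _))).integrableOn
            ((hVi _).indicator hA').integrableOn fun ω => ?_
          exact Set.indicator_le_indicator_of_subset
            hAs (hV0 (k + 1)) ω
      _ = ∫ ω in s ∩ A k, V (k + 1) ω ∂P := by
          rw [setIntegral_indicator hA']
      _ ≤ ∫ ω in s ∩ A k, V k ω ∂P := by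
          rw [heq]
          exact setIntegral_comp_le_of_indep (P := P) (G.le k) (hYm k) (hξ (k + n + 2))
            (hind.indep_comap_natural_of_lt hξ' (by omega)) (hs.inter (hAm k))
            (T := fun p => φ ((p.1 - p.2) ^ 2 + 4 / κ)) (V := fun y => φ (y ^ 2))
            (hφm.comp (((measurable_fst.sub measurable_snd).pow_const 2).add_const _))
            (heq ▸ hVi (k + 1)).integrableOn (hVi k).integrableOn
            (fun ω hω => by rw [hν]; exact hdrift _ (hω.2 k le_rfl))
      _ = ∫ ω in s, W k ω ∂P := by
          rw [← setIntegral_indicator hA']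
  filter_upwards [hconv, hlim] with ω ⟨l, hl⟩ hω
  by_contra! hcon
  have hWV : ∀ k, W k ω = V k ω := fun k => Set.indicator_of_mem (s := A k) (fun j _ => hcon j) _
  simp only [hWV] at hl
  obtain ⟨z₀, hz₀⟩ := eventually_atTop.1 (hφlim.eventually_ge_atTop (l + 1))
  obtain ⟨a, ha⟩ := eventually_atTop.1 (hl.eventually (gt_mem_nhds (lt_add_one l)))
  obtain ⟨i, hi, hlt⟩ := frequently_atTop.1 (hω (max z₀ 1)) (a + n + 1)
  obtain ⟨k, rfl⟩ : ∃ k, i = k + n + 1 := ⟨i - n - 1, by omega⟩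
  have h1 := (le_max_left z₀ 1).trans_lt hlt
  have h2 := (le_max_right z₀ 1).trans_lt hlt
  exact absurd (ha k (by omega)) (not_lt.2 (hz₀ _ (by
    change z₀ ≤ besselChain κ (fun i => ξ i ω) x (k + n + 1) ^ 2
    nlinarith)))

end Chain

/-! ### Logarithmic drift for κ > 4 -/

section Noncritical

theorem exists_setIntegral_sq_tail_le {ν : Measure ℝ} (hsq : Integrable (fun e => e ^ 2) ν)
    {δ : ℝ} (hδ : 0 < δ) :
    ∃ r₀ : ℝ, ∀ r, r₀ ≤ r → ∫ e, {e : ℝ | r < |e|}.indicator (fun e => e ^ 2) e ∂ν ≤ δ := by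
  have hlim : Tendsto (fun r : ℝ => ∫ e, {e : ℝ | r < |e|}.indicator (fun e => e ^ 2) e ∂ν) atTop
      (𝓝 (∫ _, (0 : ℝ) ∂ν)) := by
    refine tendsto_integral_filter_of_dominated_convergence (fun e => e ^ 2) ?_ ?_ hsq ?_
    · refine Eventually.of_forall fun r => Measurable.aestronglyMeasurable ?_
      exact (measurable_id.pow_const 2).indicator
        (measurableSet_lt measurable_const measurable_id.abs)
    · refine Eventually.of_forall fun r => ae_of_all _ fun e => ?_
      refine (norm_indicator_le_norm_self _ _).trans ?_
      rw [Real.norm_of_nonneg (sq_nonneg e)]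
    · refine ae_of_all _ fun e => tendsto_const_nhds.congr' ?_
      filter_upwards [eventually_ge_atTop |e|] with r hr
      rw [Set.indicator_of_notMem]
      simpa using hr
  rw [integral_zero] at hlim
  obtain ⟨r₀, h⟩ := eventually_atTop.1 (hlim.eventually (gt_mem_nhds hδ))
  exact ⟨r₀, fun r hr => (h r hr).le⟩

/-- All three drift estimates integrate a pointwise majorant of this shape: a quadratic in the step
plus a remainder. -/
theorem integral_quadratic_add {ν : Measure ℝ} [IsProbabilityMeasure ν]
    (hint : Integrable (fun e => e) ν) (hsq : Integrable (fun e => e ^ 2) ν)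
    (hmean : ∫ e, e ∂ν = 0) (hvar : ∫ e, e ^ 2 ∂ν = 1) {I : ℝ → ℝ} (hI : Integrable I ν)
    (a b d k : ℝ) :
    Integrable (fun e => a + b * e + d * e ^ 2 + k * I e) ν ∧
      ∫ e, (a + b * e + d * e ^ 2 + k * I e) ∂ν = a + d + k * ∫ e, I e ∂ν := by
  have i1 : Integrable (fun e => a + b * e) ν := (integrable_const a).add (hint.const_mul b)
  have i2 : Integrable (fun e => a + b * e + d * e ^ 2) ν := i1.add (hsq.const_mul d)
  refine ⟨i2.add (hI.const_mul k), ?_⟩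
  rw [integral_add i2 (hI.const_mul k), integral_add i1 (hsq.const_mul d),
    integral_add (integrable_const a) (hint.const_mul b), integral_const_mul, integral_const_mul,
    integral_const_mul, hmean, hvar]
  simp

/-- Used with t = e/y and s = c/y². Taylor expansion handles |t| ≤ ε; beyond that log z ≤ z - 1
suffices, and the indicator term turns -t² into t². -/
theorem log_one_sub_sq_add_le {ε t s : ℝ} (hε : 0 < ε) (hε' : ε ≤ 1 / 4) (hs : 0 < s) :
    Real.log ((1 - t) ^ 2 + s) ≤ -2 * t + (-1 + 6 * ε) * t ^ 2 + (1 + 6 * ε) * s +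
      2 * {t : ℝ | ε < |t|}.indicator (fun t => t ^ 2) t := by
  by_cases ht : ε < |t|
  · rw [Set.indicator_of_mem (by exact ht)]
    have h := Real.log_le_sub_one_of_pos (x := (1 - t) ^ 2 + s) (by positivity)
    nlinarith [mul_pos hε hs, mul_nonneg hε.le (sq_nonneg t)]
  · rw [Set.indicator_of_notMem (by simpa using ht)]
    push Not at ht
    have htl := abs_le.1 ht
    have h1t : 0 < 1 - t := by linarith
    have hlog : Real.log (1 - t) ≤ -t - t ^ 2 / 2 + 2 * ε * t ^ 2 := by
      have h := Real.abs_log_sub_add_sum_range_le (x := t) (by linarith) 2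
      have h' := (abs_le.1 h).2
      simp only [Finset.sum_range_succ, Finset.sum_range_zero] at h'
      have h3 : |t| ^ (2 + 1) / (1 - |t|) ≤ 2 * ε * t ^ 2 := by
        rw [div_le_iff₀ (by linarith), pow_succ, sq_abs]
        nlinarith [mul_nonneg (sq_nonneg t) (sub_nonneg.2 ht), mul_nonneg hε.le (sq_nonneg t),
          abs_nonneg t]
      norm_num at h'
      linarith
    have hfac : (1 - t) ^ 2 + s = (1 - t) ^ 2 * (1 + s / (1 - t) ^ 2) := by
      field_simp
    rw [hfac, Real.log_mul (by positivity) (by positivity), Real.log_pow]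
    have h2 := Real.log_le_sub_one_of_pos (x := 1 + s / (1 - t) ^ 2) (by positivity)
    have h3 : s / (1 - t) ^ 2 ≤ (1 + 6 * ε) * s := by
      rw [div_le_iff₀ (by positivity)]
      have h4 : (1 - ε) ^ 2 ≤ (1 - t) ^ 2 := pow_le_pow_left₀ (by linarith) (by linarith) 2
      have h5 : 1 ≤ (1 + 6 * ε) * (1 - ε) ^ 2 := by nlinarith [mul_pos hε hε]
      have h6 : 1 ≤ (1 + 6 * ε) * (1 - t) ^ 2 := h5.trans (by gcongr)
      nlinarith
    push_cast
    nlinarith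

theorem exists_log_drift {ν : Measure ℝ} [IsProbabilityMeasure ν]
    (hint : Integrable (fun e => e) ν) (hsq : Integrable (fun e => e ^ 2) ν)
    (hmean : ∫ e, e ∂ν = 0) (hvar : ∫ e, e ^ 2 ∂ν = 1) {c : ℝ} (hc : 0 < c) (hc1 : c < 1) :
    ∃ R : ℝ, ∀ y, R < y →
      ∫ e, (Real.log ((y - e) ^ 2 + c) - Real.log c) ∂ν ≤ Real.log (y ^ 2) - Real.log c := by
  -- The expansion costs at most 12ε = (1 - c)/2 and the tail 2 · (1 - c)/4; together they use up
  -- the drift c - 1.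
  set ε : ℝ := (1 - c) / 24 with hε_def
  have hε : 0 < ε := by rw [hε_def]; linarith
  have hε' : ε ≤ 1 / 4 := by rw [hε_def]; linarith
  obtain ⟨r₀, hr₀⟩ := exists_setIntegral_sq_tail_le hsq (δ := (1 - c) / 4) (by linarith)
  refine ⟨max 1 (r₀ / ε), fun y hy => ?_⟩
  have hy1 : 1 < y := (le_max_left _ _).trans_lt hy
  have hy0 : 0 < y := by linarith
  have hyr : r₀ ≤ ε * y := by
    have := (le_max_right 1 (r₀ / ε)).trans hy.le
    rwa [div_le_iff₀ hε, mul_comm] at this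
  have htail := hr₀ _ hyr
  set I : ℝ → ℝ := {e : ℝ | ε * y < |e|}.indicator (fun e => e ^ 2) with hI
  have hIi : Integrable I ν :=
    hsq.indicator (measurableSet_lt measurable_const measurable_id.abs)
  have hpt : ∀ e, Real.log ((y - e) ^ 2 + c) - Real.log c ≤
      (Real.log (y ^ 2) - Real.log c + (1 + 6 * ε) * c / y ^ 2) + (-2 / y) * e +
        ((-1 + 6 * ε) / y ^ 2) * e ^ 2 + (2 / y ^ 2) * I e := by
    intro e
    have h := log_one_sub_sq_add_le (t := e / y) (s := c / y ^ 2) hε hε' (by positivity)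
    have hfac : (y - e) ^ 2 + c = y ^ 2 * ((1 - e / y) ^ 2 + c / y ^ 2) := by
      field_simp
    have hInd : {t : ℝ | ε < |t|}.indicator (fun t => t ^ 2) (e / y) = I e / y ^ 2 := by
      have hiff : ε < |e / y| ↔ ε * y < |e| := by
        rw [abs_div, abs_of_pos hy0, lt_div_iff₀ hy0]
      simp only [hI, Set.indicator_apply, Set.mem_ofPred_eq, hiff]
      split_ifs
      · rw [div_pow]
      · rw [zero_div]
    rw [hfac, Real.log_mul (by positivity) (by positivity)]
    rw [hInd] at h
    have heq : -2 * (e / y) + (-1 + 6 * ε) * (e / y) ^ 2 + (1 + 6 * ε) * (c / y ^ 2) +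
        2 * (I e / y ^ 2) = (1 + 6 * ε) * c / y ^ 2 + (-2 / y) * e +
        ((-1 + 6 * ε) / y ^ 2) * e ^ 2 + (2 / y ^ 2) * I e := by
      field_simp
      ring
    linarith
  obtain ⟨hgi, hgv⟩ := integral_quadratic_add hint hsq hmean hvar hIi
    (Real.log (y ^ 2) - Real.log c + (1 + 6 * ε) * c / y ^ 2) (-2 / y) ((-1 + 6 * ε) / y ^ 2)
    (2 / y ^ 2)
  -- Subtracting log c makes the integrand nonnegative, so only the majorant has to be integrable.
  refine (integral_mono_of_nonneg (ae_of_all _ fun e => ?_) hgi (ae_of_all _ hpt)).trans ?_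
  · exact sub_nonneg.2 (Real.log_le_log hc (by nlinarith [sq_nonneg (y - e)]))
  · rw [hgv]
    have h4 : (1 + 6 * ε) * c + (-1 + 6 * ε) + 2 * ∫ e, I e ∂ν ≤ 0 := by
      have : 6 * ε * c ≤ 6 * ε := by nlinarith
      have : 12 * ε = (1 - c) / 2 := by rw [hε_def]; ring
      nlinarith
    have h5 : (1 + 6 * ε) * c / y ^ 2 + (-1 + 6 * ε) / y ^ 2 + 2 / y ^ 2 * ∫ e, I e ∂ν ≤ 0 := by
      have : (1 + 6 * ε) * c / y ^ 2 + (-1 + 6 * ε) / y ^ 2 + 2 / y ^ 2 * ∫ e, I e ∂ν =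
          ((1 + 6 * ε) * c + (-1 + 6 * ε) + 2 * ∫ e, I e ∂ν) / y ^ 2 := by ring
      rw [this]
      exact div_nonpos_of_nonpos_of_nonneg h4 (by positivity)
    linarith

end Noncritical

/-! ### Cubic Taylor bounds for log and √ -/

section Critical

/-- The difference of the two sides has derivative x³/(1 + x), so its minimum is at 0. -/
theorem log_one_add_le {x : ℝ} (hx : -1 < x) : Real.log (1 + x) ≤ x - x ^ 2 / 2 + x ^ 3 / 3 := by
  let f : ℝ → ℝ := fun x => x - x ^ 2 / 2 + x ^ 3 / 3 - Real.log (1 + x)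
  have hd : ∀ x, -1 < x → HasDerivAt f (x ^ 3 / (1 + x)) x := by
    intro x hx
    have h1 : 1 + x ≠ 0 := by linarith
    have h : HasDerivAt f _ x := (((hasDerivAt_id x).sub (((hasDerivAt_id x).pow 2).div_const 2)).add
      (((hasDerivAt_id x).pow 3).div_const 3)).sub (((hasDerivAt_id x).const_add 1).log h1)
    refine h.congr_deriv ?_
    simp only [id]
    field_simp
    ring
  have hf0 : f 0 = 0 := by simp [f]
  suffices 0 ≤ f x by
    simp only [f] at this
    linarith
  rcases le_total 0 x with h0 | h0
  · have hmono : MonotoneOn f (Set.Ici 0) := by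
      refine monotoneOn_of_deriv_nonneg (convex_Ici 0)
        (fun t ht => (hd t (by linarith [Set.mem_Ici.1 ht])).continuousAt.continuousWithinAt)
        (fun t ht => ?_) fun t ht => ?_ <;> rw [interior_Ici, Set.mem_Ioi] at ht
      · exact (hd t (by linarith)).differentiableAt.differentiableWithinAt
      · rw [(hd t (by linarith)).deriv]
        positivity
    rw [← hf0]
    exact hmono (Set.mem_Ici.2 le_rfl) (Set.mem_Ici.2 h0) h0
  · have hanti : AntitoneOn f (Set.Ioc (-1) 0) := by
      refine antitoneOn_of_deriv_nonpos (convex_Ioc _ _)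
        (fun t ht => (hd t ht.1).continuousAt.continuousWithinAt)
        (fun t ht => ?_) fun t ht => ?_ <;> rw [interior_Ioc] at ht
      · exact (hd t ht.1).differentiableAt.differentiableWithinAt
      · rw [(hd t ht.1).deriv]
        have h1 : 0 < 1 + t := by linarith [ht.1]
        have h3 : t ^ 3 ≤ 0 := by
          have := ht.2
          nlinarith [sq_nonneg t, mul_nonneg (sq_nonneg t) (neg_nonneg.2 this.le)]
        exact div_nonpos_of_nonpos_of_nonneg h3 h1.le
    rw [← hf0]
    exact hanti ⟨hx, h0⟩ ⟨by norm_num, le_rfl⟩ h0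

/-- The square of the cubic exceeds 1 + v by v⁴((v - 2)² + 16)/256, and the cubic is nonnegative for
v ≥ -1. -/
theorem sqrt_one_add_le {v : ℝ} (hv : -1 ≤ v) :
    √(1 + v) ≤ 1 + v / 2 - v ^ 2 / 8 + v ^ 3 / 16 := by
  have h1 : 0 ≤ 1 + v := by linarith
  have h0 : 0 ≤ 1 + v / 2 - v ^ 2 / 8 + v ^ 3 / 16 := by
    nlinarith [mul_nonneg h1 (sq_nonneg (v - 2)), mul_nonneg h1 (sq_nonneg v), sq_nonneg (v - 2)]
  rw [Real.sqrt_le_left h0]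
  nlinarith [sq_nonneg (v ^ 2), mul_nonneg (sq_nonneg (v ^ 2)) (sq_nonneg (v - 2)),
    mul_nonneg (sq_nonneg (v ^ 2)) (sq_nonneg v)]

/-- Taylor bound for `√` at `r ^ 2`. -/
theorem sqrt_sq_add_le {r h : ℝ} (hr : 0 < r) (hh : -r ^ 2 ≤ h) :
    √(r ^ 2 + h) ≤ r + h / (2 * r) - h ^ 2 / (8 * r ^ 3) + h ^ 3 / (16 * r ^ 5) := by
  have hv : -1 ≤ h / r ^ 2 := by
    rw [le_div_iff₀ (by positivity)]
    linarith
  have h1 := sqrt_one_add_le hv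
  have h2 : r ^ 2 + h = r ^ 2 * (1 + h / r ^ 2) := by field_simp
  rw [h2, Real.sqrt_mul (by positivity), Real.sqrt_sq hr.le]
  calc r * √(1 + h / r ^ 2)
      ≤ r * (1 + h / r ^ 2 / 2 - (h / r ^ 2) ^ 2 / 8 + (h / r ^ 2) ^ 3 / 16) := by gcongr
    _ = _ := by
      field_simp

end Critical

/-! ### Drift of √(log z) for κ = 4 -/

section Critical

/-- The square of the log bound enters the √ expansion with a minus sign, so it is bounded from
below. -/
theorem sq_sub_cube_le (x : ℝ) : x ^ 2 - x ^ 3 ≤ (x - x ^ 2 / 2 + x ^ 3 / 3) ^ 2 := by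
  have h1 : (x - x ^ 2 / 2 + x ^ 3 / 3) ^ 2 =
      x ^ 2 - x ^ 3 + x ^ 4 * ((x / 3 - 1 / 2) ^ 2 + 2 / 3) := by ring
  rw [h1]
  have h2 : 0 ≤ x ^ 4 * ((x / 3 - 1 / 2) ^ 2 + 2 / 3) := by positivity
  linarith

/-- A one-sided bound is enough: it feeds only the cubic term of the √ expansion, and cubing is
monotone. -/
theorem cubic_le {x B i : ℝ} (hB : 1 ≤ B) (hi : 0 ≤ i) (hi1 : i ≤ 1) (hx : |x| ≤ B * i) :
    x - x ^ 2 / 2 + x ^ 3 / 3 ≤ 2 * B ^ 3 * i := by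
  have hx3 : x ^ 3 ≤ B ^ 3 * i ^ 3 := by
    rw [← mul_pow]
    calc x ^ 3 ≤ |x ^ 3| := le_abs_self _
      _ = |x| ^ 3 := abs_pow x 3
      _ ≤ (B * i) ^ 3 := by gcongr
  have e1 : x ≤ B * i := (le_abs_self x).trans hx
  have e2 : B * i ≤ B ^ 3 * i := by
    gcongr
    simpa using pow_le_pow_right₀ hB (show 1 ≤ 3 by norm_num)
  have e3 : i ^ 3 ≤ i := by simpa using pow_le_pow_of_le_one hi hi1 (show 1 ≤ 3 by norm_num)
  have e4 : B ^ 3 * i ^ 3 ≤ B ^ 3 * i := by gcongr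
  have e5 : 0 ≤ B ^ 3 * i := by positivity
  linarith [sq_nonneg x]

theorem abs_increment_le {e i : ℝ} (hi : 0 ≤ i) (hi1 : i ≤ 1) :
    |-2 * e * i + (e ^ 2 + 1) * i ^ 2| ≤ (1 + |e|) ^ 2 * i := by
  have hi2 : i ^ 2 ≤ i := by nlinarith
  have hB : (1 + |e|) ^ 2 = 2 * |e| + (e ^ 2 + 1) := by rw [← sq_abs e]; ring
  have h1 := mul_le_mul_of_nonneg_right (le_abs_self e) hi
  have h2 := mul_le_mul_of_nonneg_right (neg_abs_le e) hi
  have h3 : (e ^ 2 + 1) * i ^ 2 ≤ (e ^ 2 + 1) * i := by gcongr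
  have h4 : 0 ≤ (e ^ 2 + 1) * i ^ 2 := by positivity
  have h5 : 0 ≤ (e ^ 2 + 1) * i := by positivity
  rw [hB, abs_le]
  constructor <;> linarith

/-- Only the cross term can be negative; |e| ≤ B/2 and e² + 1 ≤ B for B = (1 + |e|)² bound it. -/
theorem le_increment_sq {e i : ℝ} (hi : 0 ≤ i) :
    4 * e ^ 2 * i ^ 2 - 2 * ((1 + |e|) ^ 2) ^ 2 * i ^ 3 ≤
      (-2 * e * i + (e ^ 2 + 1) * i ^ 2) ^ 2 := by
  have hB : (1 + |e|) ^ 2 = 2 * |e| + (e ^ 2 + 1) := by rw [← sq_abs e]; ring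
  have h1 : e * (e ^ 2 + 1) ≤ (1 + |e|) ^ 2 / 2 * (1 + |e|) ^ 2 := by
    calc e * (e ^ 2 + 1) ≤ |e| * (e ^ 2 + 1) := by gcongr; exact le_abs_self e
      _ ≤ (1 + |e|) ^ 2 / 2 * (1 + |e|) ^ 2 := by
        refine mul_le_mul ?_ ?_ (by positivity) (by positivity)
        · linarith [sq_nonneg e]
        · linarith [abs_nonneg e]
  have h2 := mul_le_mul_of_nonneg_right h1 (pow_nonneg hi 3)
  have h3 : (-2 * e * i + (e ^ 2 + 1) * i ^ 2) ^ 2 =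
      4 * e ^ 2 * i ^ 2 - 4 * (e * (e ^ 2 + 1) * i ^ 3) + ((e ^ 2 + 1) * i ^ 2) ^ 2 := by ring
  linarith [sq_nonneg ((e ^ 2 + 1) * i ^ 2)]

/-- The log bound is inserted into the √ expansion. Every error is at most a multiple of B⁹y⁻³ with
B = (1 + |e|)², hence the exponent 18. The term with r³ is the gain from concavity. -/
theorem sqrt_log_sub_sq_add_one_le {y e : ℝ} (hy : 1 ≤ y) (hr : 1 ≤ √(Real.log (y ^ 2))) :
    √(Real.log ((y - e) ^ 2 + 1)) ≤
      (√(Real.log (y ^ 2)) + y⁻¹ ^ 2 / (2 * √(Real.log (y ^ 2)))) +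
      (-(y⁻¹ / √(Real.log (y ^ 2)))) * e +
      (-(y⁻¹ ^ 2 / (2 * √(Real.log (y ^ 2)))) - y⁻¹ ^ 2 / (2 * √(Real.log (y ^ 2)) ^ 3)) * e ^ 2 +
      2 * y⁻¹ ^ 3 * (1 + |e|) ^ 18 := by
  set r := √(Real.log (y ^ 2)) with hr_def
  have hr0 : 0 < r := by linarith
  have hrsq : r ^ 2 = Real.log (y ^ 2) :=
    Real.sq_sqrt (Real.log_nonneg (by nlinarith))
  have hy0 : 0 < y := by linarith
  set i := y⁻¹ with hi_def
  have hi0 : 0 < i := inv_pos.2 hy0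
  have hi1 : i ≤ 1 := inv_le_one_of_one_le₀ hy
  set B := (1 + |e|) ^ 2 with hB_def
  have habs := abs_nonneg e
  have hB1 : 1 ≤ B := by rw [hB_def]; nlinarith
  have hB0 : 0 < B := by linarith
  set x := -2 * e * i + (e ^ 2 + 1) * i ^ 2 with hx_def
  have hxB : |x| ≤ B * i := abs_increment_le hi0.le hi1
  have hZ : (y - e) ^ 2 + 1 = y ^ 2 * (1 + x) := by
    rw [hx_def, hi_def]
    field_simp
    ring
  have hx1 : 0 < 1 + x := by
    have : 0 < y ^ 2 * (1 + x) := by rw [← hZ]; positivity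
    exact (pos_iff_pos_of_mul_pos this).1 (by positivity)
  set h := x - x ^ 2 / 2 + x ^ 3 / 3 with hh_def
  have hlog : Real.log ((y - e) ^ 2 + 1) ≤ r ^ 2 + h := by
    rw [hZ, Real.log_mul (by positivity) hx1.ne', hrsq]
    linarith [log_one_add_le (x := x) (by linarith)]
  -- This gives h ≥ -r², the range in which the √ expansion is valid.
  have hlog0 : 0 ≤ Real.log ((y - e) ^ 2 + 1) := Real.log_nonneg (by nlinarith [sq_nonneg (y - e)])
  refine (Real.sqrt_le_sqrt hlog).trans ((sqrt_sq_add_le hr0 (by linarith)).trans ?_)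
  have hB23 : B ^ 2 ≤ B ^ 3 := pow_le_pow_right₀ hB1 (by norm_num)
  have hB13 : B ≤ B ^ 3 := by simpa using pow_le_pow_right₀ hB1 (show 1 ≤ 3 by norm_num)
  have hB39 : B ^ 3 ≤ B ^ 9 := pow_le_pow_right₀ hB1 (by norm_num)
  have hi3 : 0 < i ^ 3 := by positivity
  have hx3 : x ^ 3 ≤ B ^ 3 * i ^ 3 := by
    rw [← mul_pow]
    calc x ^ 3 ≤ |x ^ 3| := le_abs_self _
      _ = |x| ^ 3 := abs_pow x 3
      _ ≤ (B * i) ^ 3 := by gcongr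
  have hx2 : 4 * e ^ 2 * i ^ 2 - 2 * B ^ 2 * i ^ 3 ≤ x ^ 2 := le_increment_sq hi0.le
  have hb23 : B ^ 2 * i ^ 3 ≤ B ^ 3 * i ^ 3 := by gcongr
  have hh1 : h ≤ -2 * e * i + (1 - e ^ 2) * i ^ 2 + 2 * (B ^ 3 * i ^ 3) := by
    have h0 : 0 ≤ B ^ 3 * i ^ 3 := by positivity
    rw [hh_def]
    linarith
  have hh2 : 4 * e ^ 2 * i ^ 2 - 3 * (B ^ 3 * i ^ 3) ≤ h ^ 2 := by
    have h1 : x ^ 2 - x ^ 3 ≤ h ^ 2 := sq_sub_cube_le x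
    linarith
  have hh3 : h ^ 3 ≤ 8 * (B ^ 9 * i ^ 3) := by
    have h1 : h ≤ 2 * B ^ 3 * i := cubic_le hB1 hi0.le hi1 hxB
    calc h ^ 3 ≤ (2 * B ^ 3 * i) ^ 3 := (Odd.strictMono_pow (by decide : Odd 3)).monotone h1
      _ = 8 * (B ^ 9 * i ^ 3) := by ring
  have hr3 : 1 ≤ r ^ 3 := one_le_pow₀ hr
  have hr5 : 1 ≤ r ^ 5 := one_le_pow₀ hr
  set K := B ^ 9 * i ^ 3 with hK_def
  have hK0 : 0 < K := by positivity
  have hK : B ^ 3 * i ^ 3 ≤ K := by rw [hK_def]; gcongr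
  have hK' : 2 * i ^ 3 * (1 + |e|) ^ 18 = 2 * K := by rw [hK_def, hB_def]; ring
  have t1 : h / (2 * r) ≤ (-2 * e * i + (1 - e ^ 2) * i ^ 2) / (2 * r) + K := by
    rw [div_add' _ _ _ (by positivity)]
    gcongr
    have : K * 2 ≤ K * (2 * r) := by gcongr; linarith
    linarith
  have t2 : 4 * e ^ 2 * i ^ 2 / (8 * r ^ 3) - 3 / 8 * K ≤ h ^ 2 / (8 * r ^ 3) := by
    rw [div_sub' (by positivity)]
    gcongr
    have : K * 1 ≤ K * r ^ 3 := by gcongr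
    linarith
  have t3 : h ^ 3 / (16 * r ^ 5) ≤ 1 / 2 * K := by
    rw [div_le_iff₀ (by positivity)]
    have : K * 1 ≤ K * r ^ 5 := by gcongr
    linarith
  have heq : (-2 * e * i + (1 - e ^ 2) * i ^ 2) / (2 * r) - 4 * e ^ 2 * i ^ 2 / (8 * r ^ 3) =
      i ^ 2 / (2 * r) + (-(i / r)) * e + (-(i ^ 2 / (2 * r)) - i ^ 2 / (2 * r ^ 3)) * e ^ 2 := by
    field_simp
    ring
  rw [hK']
  linarith

theorem exists_sqrt_log_drift {ν : Measure ℝ} [IsProbabilityMeasure ν]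
    (hint : Integrable (fun e => e) ν) (hsq : Integrable (fun e => e ^ 2) ν)
    (hmean : ∫ e, e ∂ν = 0) (hvar : ∫ e, e ^ 2 ∂ν = 1)
    (hmom : Integrable (fun e => (1 + |e|) ^ 18) ν) :
    ∃ R : ℝ, ∀ y, R < y → ∫ e, √(Real.log ((y - e) ^ 2 + 1)) ∂ν ≤ √(Real.log (y ^ 2)) := by
  set K := ∫ e, (1 + |e|) ^ 18 ∂ν with hK_def
  have hK0 : 0 ≤ K := integral_nonneg fun e => by positivity
  -- After averaging, the y⁻²/(2r) terms cancel and 4Kr³ ≤ y remains to be shown; r³ ≤ r⁴ = 4 log² y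
  -- gives the constant 16.
  have ho := (Real.isLittleO_pow_log_id_atTop (n := 2)).bound
    (show (0 : ℝ) < 1 / (16 * (K + 1)) by positivity)
  obtain ⟨R, hR⟩ := eventually_atTop.1 (ho.and ((eventually_ge_atTop 1).and
    (Real.tendsto_log_atTop.eventually_ge_atTop 1)))
  refine ⟨R, fun y hy => ?_⟩
  obtain ⟨hb, hy1, hl1⟩ := hR y hy.le
  have hy0 : 0 < y := by linarith
  have hlog : Real.log (y ^ 2) = 2 * Real.log y := by rw [Real.log_pow]; norm_num
  have hr : 1 ≤ √(Real.log (y ^ 2)) := by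
    rw [Real.one_le_sqrt, hlog]
    linarith
  obtain ⟨hgi, hgv⟩ := integral_quadratic_add hint hsq hmean hvar hmom
    (√(Real.log (y ^ 2)) + y⁻¹ ^ 2 / (2 * √(Real.log (y ^ 2)))) (-(y⁻¹ / √(Real.log (y ^ 2))))
    (-(y⁻¹ ^ 2 / (2 * √(Real.log (y ^ 2)))) - y⁻¹ ^ 2 / (2 * √(Real.log (y ^ 2)) ^ 3))
    (2 * y⁻¹ ^ 3)
  refine (integral_mono_of_nonneg (ae_of_all _ fun e => Real.sqrt_nonneg _) hgi
    (ae_of_all _ fun e => sqrt_log_sub_sq_add_one_le hy1 hr)).trans ?_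
  rw [hgv, ← hK_def]
  have hrsq : √(Real.log (y ^ 2)) ^ 2 = 2 * Real.log y := by
    rw [Real.sq_sqrt (by rw [hlog]; linarith), hlog]
  set r := √(Real.log (y ^ 2))
  have hr3 : r ^ 3 ≤ 4 * Real.log y ^ 2 := by
    calc r ^ 3 ≤ r ^ 4 := pow_le_pow_right₀ hr (by norm_num)
      _ = (r ^ 2) ^ 2 := by ring
      _ = 4 * Real.log y ^ 2 := by rw [hrsq]; ring
  have hyK : 16 * (K + 1) * Real.log y ^ 2 ≤ y := by
    rw [Real.norm_of_nonneg (by positivity), id, Real.norm_of_nonneg hy0.le, div_mul_eq_mul_div,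
      one_mul, le_div_iff₀ (by positivity)] at hb
    linarith
  have hfin : 4 * K * r ^ 3 ≤ y := by
    nlinarith [mul_le_mul_of_nonneg_left hr3 hK0, sq_nonneg (Real.log y)]
  have hr0 : 0 < r := by linarith
  have : 2 * y⁻¹ ^ 3 * K ≤ y⁻¹ ^ 2 / (2 * r ^ 3) := by
    rw [le_div_iff₀ (by positivity)]
    calc 2 * y⁻¹ ^ 3 * K * (2 * r ^ 3) = y⁻¹ ^ 3 * (4 * K * r ^ 3) := by ring
      _ ≤ y⁻¹ ^ 3 * y := by gcongr
      _ = y⁻¹ ^ 2 := by field_simp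
  linarith

end Critical

/-! ### Drift at a single scale for κ < 4 -/

section Supercritical

theorem one_add_rpow_neg_le {x η : ℝ} (hx : |x| ≤ 1 / 2) (hη : 0 < η) (hη1 : η ≤ 1 / 2) :
    (1 + x) ^ (-η) ≤ 1 - η * x + η * (1 / 2 + 2 * |x| + 4 * η) * x ^ 2 := by
  have hxl := abs_le.1 hx
  have habs := abs_nonneg x
  have h0 : 0 < 1 + x := by linarith
  have hx3 : |x| ^ 3 = |x| * x ^ 2 := by rw [← sq_abs x]; ring
  have hlog := Real.abs_log_sub_add_sum_range_le (x := -x) (by rw [abs_neg]; linarith) 2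
  simp only [Finset.sum_range_succ, Finset.sum_range_zero, abs_neg, sub_neg_eq_add] at hlog
  have h3 : |x| ^ (2 + 1) / (1 - |x|) ≤ 2 * |x| * x ^ 2 := by
    rw [div_le_iff₀ (by linarith)]
    norm_num
    rw [hx3]
    have : 0 ≤ |x| * x ^ 2 := by positivity
    nlinarith
  have hlog' := abs_le.1 (hlog.trans h3)
  norm_num at hlog'
  set L := Real.log (1 + x)
  have hsq : x ^ 2 ≤ |x| / 2 := by rw [← sq_abs]; nlinarith
  have hL : |L| ≤ 2 * |x| := by
    have h4 : 2 * |x| * x ^ 2 ≤ x ^ 2 := by nlinarith [sq_nonneg x]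
    rw [abs_le]
    constructor <;> linarith [le_abs_self x, neg_abs_le x]
  have hv : |L * -η| ≤ 1 := by
    rw [abs_mul, abs_neg, abs_of_pos hη]
    nlinarith [abs_nonneg L]
  have hexp := (abs_le.1 (Real.abs_exp_sub_one_sub_id_le hv)).2
  rw [Real.rpow_def_of_pos h0]
  have hL2 : L ^ 2 ≤ 4 * x ^ 2 := by
    rw [← sq_abs L, ← sq_abs x]
    nlinarith [abs_nonneg L]
  have h5 : η * (x - x ^ 2 / 2 - 2 * |x| * x ^ 2) ≤ η * L := by
    gcongr
    linarith
  have h6 : η ^ 2 * L ^ 2 ≤ η ^ 2 * (4 * x ^ 2) := by gcongr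
  change Real.exp (L * -η) ≤ _
  nlinarith

/-- The weighted inequality (p + q)² ≤ (1 + ε)p² + (1 + 1/ε)q² isolates the main term 4y²e². -/
theorem sq_increment_le {ε y c e w : ℝ} (hε : 0 < ε) (hε1 : ε ≤ 1 / 100)
    (hw : y ^ 2 ≤ w) (hc : 2 * (1 + 1 / ε) * c ^ 2 ≤ ε * w) (he : e ^ 2 ≤ ε ^ 2 * y ^ 2) :
    (-2 * y * e + e ^ 2 + c) ^ 2 ≤ w * (4 * e ^ 2 * (1 + 2 * ε) + ε) := by
  have h1 : (-2 * y * e + e ^ 2 + c) ^ 2 ≤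
      (1 + ε) * (4 * y ^ 2 * e ^ 2) + (1 + 1 / ε) * (e ^ 2 + c) ^ 2 := by
    have h : (1 + ε) * (4 * y ^ 2 * e ^ 2) + (1 + 1 / ε) * (e ^ 2 + c) ^ 2 -
        (-2 * y * e + e ^ 2 + c) ^ 2 = (ε * (2 * y * e) + (e ^ 2 + c)) ^ 2 / ε := by
      field_simp
      ring
    have : 0 ≤ (ε * (2 * y * e) + (e ^ 2 + c)) ^ 2 / ε := by positivity
    linarith
  have h2 : (e ^ 2 + c) ^ 2 ≤ 2 * (ε ^ 2 * y ^ 2) * e ^ 2 + 2 * c ^ 2 := by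
    have := mul_le_mul_of_nonneg_right he (sq_nonneg e)
    nlinarith [sq_nonneg (e ^ 2 - c)]
  have h3 : (1 + 1 / ε) * (e ^ 2 + c) ^ 2 ≤
      (1 + 1 / ε) * (2 * (ε ^ 2 * y ^ 2) * e ^ 2 + 2 * c ^ 2) := by gcongr
  have h4 : (1 + 1 / ε) * (2 * (ε ^ 2 * y ^ 2) * e ^ 2) = 2 * ε * (1 + ε) * (y ^ 2 * e ^ 2) := by
    field_simp
    ring
  have h5 : y ^ 2 * e ^ 2 ≤ w * e ^ 2 := by gcongr
  have h6 : 2 * ε * (1 + ε) * (y ^ 2 * e ^ 2) ≤ 4 * ε * (y ^ 2 * e ^ 2) := by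
    have h : 0 ≤ ε * (1 - ε) * (y ^ 2 * e ^ 2) :=
      mul_nonneg (mul_nonneg hε.le (by linarith)) (by positivity)
    linarith
  have h7 : (4 + 8 * ε) * (y ^ 2 * e ^ 2) ≤ (4 + 8 * ε) * (w * e ^ 2) := by gcongr
  nlinarith

/-- With w = b + y² and increment D of z, the function is multiplied by (1 + D/w)^(-ε). The
coefficient of e² is -1 from -D plus 2 from D²/(2w), up to O(ε). -/
theorem div_add_rpow_le_of_abs_le {ε y c b e : ℝ} (hε : 0 < ε) (hε1 : ε ≤ 1 / 100) (hy : 0 < y)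
    (hb : 0 < b) (hc : 0 < c) (hcy : c ≤ ε * y ^ 2) (hcy' : 2 * (1 + 1 / ε) * c ^ 2 ≤ ε * y ^ 2)
    (he : |e| ≤ ε * y) :
    (b / (b + ((y - e) ^ 2 + c))) ^ ε ≤ (b / (b + y ^ 2)) ^ ε +
      ε * ((b / (b + y ^ 2)) ^ ε / (b + y ^ 2)) * (ε - c + 2 * y * e + (1 + 60 * ε) * e ^ 2) := by
  set w := b + y ^ 2 with hw_def
  have hw : 0 < w := by positivity
  have hyw : y ^ 2 ≤ w := by linarith
  set D := -2 * y * e + e ^ 2 + c with hD_def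
  have hesq : e ^ 2 ≤ ε ^ 2 * y ^ 2 := by
    rw [← sq_abs, ← mul_pow]
    gcongr
  have hD2 := sq_increment_le hε hε1 hyw (hcy'.trans (by gcongr)) hesq
  rw [← hD_def] at hD2
  have hsum : b + ((y - e) ^ 2 + c) = w * (1 + D / w) := by
    rw [mul_add, mul_div_cancel₀ _ hw.ne', hw_def, hD_def]
    ring
  have hDabs : |D| ≤ 4 * ε * y ^ 2 := by
    have h1 : |y * e| ≤ ε * y ^ 2 := by
      rw [abs_mul, abs_of_pos hy]
      nlinarith
    have h1' := abs_le.1 h1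
    have h2 : ε ^ 2 * y ^ 2 ≤ ε * y ^ 2 := by
      gcongr
      nlinarith
    have hsqe := sq_nonneg e
    rw [hD_def, abs_le]
    constructor <;> linarith
  have hx : |D / w| ≤ 4 * ε := by
    rw [abs_div, abs_of_pos hw, div_le_iff₀ hw]
    exact hDabs.trans (by gcongr)
  have h1x : 0 < 1 + D / w := by linarith [(abs_le.1 hx).1]
  have hfac : (b / (b + ((y - e) ^ 2 + c))) ^ ε = (b / w) ^ ε * (1 + D / w) ^ (-ε) := by
    rw [hsum, ← div_div, div_eq_mul_inv _ (1 + D / w), Real.mul_rpow (by positivity)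
      (by positivity), Real.inv_rpow h1x.le, Real.rpow_neg h1x.le]
  have hT := one_add_rpow_neg_le (x := D / w) (η := ε) (by linarith) hε (by linarith)
  have hT2 : (1 + D / w) ^ (-ε) ≤
      1 + ε / w * (ε - c + 2 * y * e + (1 + 60 * ε) * e ^ 2) := by
    have h1 : (D / w) ^ 2 ≤ (4 * e ^ 2 * (1 + 2 * ε) + ε) / w := by
      rw [div_pow, div_le_div_iff₀ (by positivity) hw]
      calc D ^ 2 * w ≤ w * (4 * e ^ 2 * (1 + 2 * ε) + ε) * w := by gcongr
        _ = (4 * e ^ 2 * (1 + 2 * ε) + ε) * w ^ 2 := by ring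
    have h2 : ε * (1 / 2 + 2 * |D / w| + 4 * ε) * (D / w) ^ 2 ≤
        ε * (1 / 2 + 2 * (4 * ε) + 4 * ε) * ((4 * e ^ 2 * (1 + 2 * ε) + ε) / w) := by
      gcongr
    have h3 : (1 / 2 + 2 * (4 * ε) + 4 * ε) * (4 * e ^ 2 * (1 + 2 * ε) + ε) ≤
        (2 + 60 * ε) * e ^ 2 + ε := by
      have h4 : ε ^ 2 ≤ ε / 100 := by nlinarith
      have h5 : ε ^ 2 * e ^ 2 ≤ ε / 100 * e ^ 2 := by gcongr
      have h6 : 0 ≤ ε * e ^ 2 := by positivity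
      nlinarith
    have h4 : ε / w * ((1 / 2 + 2 * (4 * ε) + 4 * ε) * (4 * e ^ 2 * (1 + 2 * ε) + ε)) ≤
        ε / w * ((2 + 60 * ε) * e ^ 2 + ε) := by gcongr
    calc (1 + D / w) ^ (-ε) ≤ _ := hT
      _ ≤ 1 - ε * (D / w) +
          ε * (1 / 2 + 2 * (4 * ε) + 4 * ε) * ((4 * e ^ 2 * (1 + 2 * ε) + ε) / w) := by
        linarith
      _ = 1 - ε / w * D +
          ε / w * ((1 / 2 + 2 * (4 * ε) + 4 * ε) * (4 * e ^ 2 * (1 + 2 * ε) + ε)) := by ring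
      _ ≤ 1 - ε / w * D + ε / w * ((2 + 60 * ε) * e ^ 2 + ε) := by linarith
      _ = _ := by rw [hD_def]; ring
  rw [hfac]
  calc (b / w) ^ ε * (1 + D / w) ^ (-ε)
      ≤ (b / w) ^ ε * (1 + ε / w * (ε - c + 2 * y * e + (1 + 60 * ε) * e ^ 2)) := by gcongr
    _ = _ := by ring

theorem div_add_rpow_le_one {ε b z : ℝ} (hε : 0 < ε) (hb : 0 < b) (hz : 0 ≤ z) :
    (b / (b + z)) ^ ε ≤ 1 :=
  Real.rpow_le_one (by positivity) ((div_le_one (by positivity)).2 (by linarith)) hε.le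

/-- For a long jump the left side is at most 1, and the e² in the indicator offsets the linear term,
because εy|e| ≤ e² there. -/
theorem div_add_rpow_le {ε y c b e : ℝ} (hε : 0 < ε) (hε1 : ε ≤ 1 / 100) (hy : 0 < y)
    (hb : 0 < b) (hc : 0 < c) (hcy : c ≤ ε ^ 2 * y ^ 2)
    (hcy' : 2 * (1 + 1 / ε) * c ^ 2 ≤ ε * y ^ 2) :
    (b / (b + ((y - e) ^ 2 + c))) ^ ε ≤ (b / (b + y ^ 2)) ^ ε +
      ε * ((b / (b + y ^ 2)) ^ ε / (b + y ^ 2)) * (ε - c + 2 * y * e + (1 + 60 * ε) * e ^ 2) +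
      {e : ℝ | ε * y < |e|}.indicator
        (fun e => 2 * ((b / (b + y ^ 2)) ^ ε / (b + y ^ 2)) * e ^ 2 + 1) e := by
  by_cases he : ε * y < |e|
  · rw [Set.indicator_of_mem (by exact he)]
    refine (div_add_rpow_le_one hε hb (by positivity)).trans ?_
    set g := (b / (b + y ^ 2)) ^ ε
    have hg : 0 ≤ g := by positivity
    set Q := g / (b + y ^ 2)
    have hQ : 0 ≤ Q := by positivity
    have hesq : c ≤ e ^ 2 := by
      refine hcy.trans ?_
      rw [← sq_abs e, ← mul_pow]
      gcongr
    have hye : -(2 * e ^ 2) ≤ ε * (2 * y * e) := by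
      have h1 : -|e| ≤ e := neg_abs_le e
      have h2 : ε * y * |e| ≤ e ^ 2 := by
        rw [← sq_abs e]
        nlinarith [abs_nonneg e]
      have h3 : ε * y * -|e| ≤ ε * y * e := by gcongr
      linarith
    have h4 : 0 ≤ ε * (ε - c + 2 * y * e + (1 + 60 * ε) * e ^ 2) + 2 * e ^ 2 := by
      have h5 : 0 ≤ ε * (ε + (e ^ 2 - c) + 60 * ε * e ^ 2) := by
        have : 0 ≤ e ^ 2 - c := by linarith
        positivity
      linarith
    have h6 := mul_nonneg hQ h4
    linarith
  · rw [Set.indicator_of_notMem (by exact he), add_zero]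
    refine div_add_rpow_le_of_abs_le hε hε1 hy hb hc (hcy.trans ?_) hcy' (not_lt.1 he)
    gcongr
    nlinarith

/-- Drift of the basic functions, uniformly in the scale `b`. -/
theorem integral_div_add_rpow_le {ν : Measure ℝ} [IsProbabilityMeasure ν]
    (hint : Integrable (fun e => e) ν) (hsq : Integrable (fun e => e ^ 2) ν)
    (hmean : ∫ e, e ∂ν = 0) (hvar : ∫ e, e ^ 2 ∂ν = 1) {ε y c b : ℝ} (hε : 0 < ε)
    (hε1 : ε ≤ 1 / 100) (hεc : 126 * ε ≤ c - 1) (hy : 0 < y) (hb : 0 < b)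
    (hcy : c ≤ ε ^ 2 * y ^ 2) (hcy' : 2 * (1 + 1 / ε) * c ^ 2 ≤ ε * y ^ 2)
    (htail : ∫ e, {e : ℝ | ε * y < |e|}.indicator (fun e => e ^ 2) e ∂ν ≤ ε ^ 2) :
    ∫ e, (b / (b + ((y - e) ^ 2 + c))) ^ ε ∂ν ≤ (b / (b + y ^ 2)) ^ ε -
      ε * (c - 1) / 2 * ((b / (b + y ^ 2)) ^ ε / (b + y ^ 2)) +
      ∫ e, {e : ℝ | ε * y < |e|}.indicator (fun _ => 1) e ∂ν := by
  have hc : 0 < c := by linarith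
  have hS : MeasurableSet {e : ℝ | ε * y < |e|} :=
    measurableSet_lt measurable_const measurable_id.abs
  set S := {e : ℝ | ε * y < |e|}
  set g := (b / (b + y ^ 2)) ^ ε
  set Q := g / (b + y ^ 2) with hQ_def
  have hQ : 0 ≤ Q := by positivity
  have i1 : Integrable (S.indicator fun e => e ^ 2) ν := hsq.indicator hS
  have i2 : Integrable (S.indicator fun _ => (1 : ℝ)) ν := (integrable_const 1).indicator hS
  have hsplit : ∀ e, S.indicator (fun e => 2 * Q * e ^ 2 + 1) e =
      2 * Q * S.indicator (fun e => e ^ 2) e + S.indicator (fun _ => (1 : ℝ)) e := by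
    intro e
    by_cases he : e ∈ S <;> simp [he]
  have hI : Integrable (S.indicator fun e => 2 * Q * e ^ 2 + 1) ν := by
    rw [funext hsplit]
    exact (i1.const_mul _).add i2
  have hIv : ∫ e, S.indicator (fun e => 2 * Q * e ^ 2 + 1) e ∂ν =
      2 * Q * ∫ e, S.indicator (fun e => e ^ 2) e ∂ν + ∫ e, S.indicator (fun _ => (1 : ℝ)) e ∂ν := by
    rw [funext hsplit, integral_add (i1.const_mul _) i2, integral_const_mul]
  obtain ⟨hgi, hgv⟩ := integral_quadratic_add hint hsq hmean hvar hI (g + ε * Q * (ε - c))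
    (ε * Q * (2 * y)) (ε * Q * (1 + 60 * ε)) 1
  refine (integral_mono_of_nonneg (ae_of_all _ fun e => by positivity) hgi
    (ae_of_all _ fun e => ?_)).trans ?_
  · refine (div_add_rpow_le hε hε1 hy hb hc hcy hcy').trans (le_of_eq ?_)
    ring
  · rw [hgv, hIv]
    have h1 : 2 * Q * ∫ e, S.indicator (fun e => e ^ 2) e ∂ν ≤ 2 * Q * ε ^ 2 := by gcongr
    -- The losses total 61ε from the expansion and 2ε from the tail; 63ε is at most half of c - 1.
    have h2 : ε * Q * (126 * ε) ≤ ε * Q * (c - 1) := by gcongr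
    have h3 : 0 ≤ ε * Q * ε := by positivity
    nlinarith

end Supercritical

/-! ### Mixing over scales to absorb long jumps -/

section Supercritical

/-- The mixture of the functions `z ↦ (b / (b + z)) ^ ε` over scales `b ζ` with weights `W ζ`. -/
noncomputable def scaleMixture (ν : Measure ℝ) (ε : ℝ) (W b : ℝ → ℝ) (z : ℝ) : ℝ :=
  ∫ ζ, W ζ * (b ζ / (b ζ + z)) ^ ε ∂ν

variable {ν : Measure ℝ} {ε : ℝ} {W b : ℝ → ℝ}

theorem measurable_scaleMixture_integrand (hWm : Measurable W) (hbm : Measurable b) :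
    Measurable fun p : ℝ × ℝ => W p.2 * (b p.2 / (b p.2 + p.1)) ^ ε := by
  have h1 : Measurable fun p : ℝ × ℝ => b p.2 := hbm.comp measurable_snd
  exact (hWm.comp measurable_snd).mul ((h1.div (h1.add measurable_fst)).pow_const ε)

theorem measurable_scaleMixture [SFinite ν] (hWm : Measurable W) (hbm : Measurable b) :
    Measurable (scaleMixture ν ε W b) :=
  ((measurable_scaleMixture_integrand hWm hbm).stronglyMeasurable.integral_prod_right'
    (ν := ν)).measurable

theorem norm_scaleMixture_integrand_le (hε : 0 < ε) (hb : ∀ ζ, 0 < b ζ) (hW : ∀ ζ, 0 < W ζ)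
    {z : ℝ} (hz : 0 ≤ z) (ζ : ℝ) : ‖W ζ * (b ζ / (b ζ + z)) ^ ε‖ ≤ W ζ := by
  have h1 := hb ζ
  have h2 := (hW ζ).le
  rw [Real.norm_of_nonneg (by positivity)]
  exact mul_le_of_le_one_right h2 (div_add_rpow_le_one hε h1 hz)

theorem integrable_scaleMixture_integrand (hε : 0 < ε) (hWm : Measurable W) (hbm : Measurable b)
    (hb : ∀ ζ, 0 < b ζ) (hW : ∀ ζ, 0 < W ζ) (hWi : Integrable W ν) {z : ℝ} (hz : 0 ≤ z) :
    Integrable (fun ζ => W ζ * (b ζ / (b ζ + z)) ^ ε) ν :=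
  hWi.mono' ((measurable_scaleMixture_integrand hWm hbm).comp
    measurable_prodMk_left).aestronglyMeasurable
    (ae_of_all _ (norm_scaleMixture_integrand_le hε hb hW hz))

theorem scaleMixture_pos [IsProbabilityMeasure ν] (hε : 0 < ε) (hWm : Measurable W) (hbm : Measurable b)
    {b₀ w₀ : ℝ} (hb₀ : 0 < b₀) (hw₀ : 0 < w₀) (hb : ∀ ζ, b₀ ≤ b ζ) (hW : ∀ ζ, w₀ ≤ W ζ)
    (hWi : Integrable W ν) {z : ℝ} (hz : 0 ≤ z) : 0 < scaleMixture ν ε W b z := by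
  have hlow : ∀ ζ, w₀ * (b₀ / (b₀ + z)) ^ ε ≤ W ζ * (b ζ / (b ζ + z)) ^ ε := fun ζ => by
    have h0 : 0 < b ζ := hb₀.trans_le (hb ζ)
    have h1 : b₀ / (b₀ + z) ≤ b ζ / (b ζ + z) := by
      rw [div_le_div_iff₀ (by positivity) (by positivity)]
      nlinarith [hb ζ]
    exact mul_le_mul (hW ζ) (Real.rpow_le_rpow (by positivity) h1 hε.le) (by positivity)
      (hw₀.le.trans (hW ζ))
  have h := integral_mono (μ := ν) (integrable_const _) (integrable_scaleMixture_integrand hε hWm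
    hbm (fun ζ => hb₀.trans_le (hb ζ)) (fun ζ => hw₀.trans_le (hW ζ)) hWi hz) hlow
  simp only [integral_const, probReal_univ, one_smul] at h
  exact lt_of_lt_of_le (by positivity) h

theorem antitoneOn_scaleMixture (hε : 0 < ε) (hWm : Measurable W) (hbm : Measurable b)
    (hb : ∀ ζ, 0 < b ζ) (hW : ∀ ζ, 0 < W ζ) (hWi : Integrable W ν) :
    AntitoneOn (scaleMixture ν ε W b) (Set.Ici 0) := by
  intro z (hz : 0 ≤ z) z' (hz' : 0 ≤ z') hzz
  refine integral_mono (integrable_scaleMixture_integrand hε hWm hbm hb hW hWi hz')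
    (integrable_scaleMixture_integrand hε hWm hbm hb hW hWi hz) fun ζ => ?_
  have h1 := hb ζ
  have h2 := (hW ζ).le
  change W ζ * (b ζ / (b ζ + z')) ^ ε ≤ W ζ * (b ζ / (b ζ + z)) ^ ε
  gcongr

theorem tendsto_scaleMixture (hε : 0 < ε) (hWm : Measurable W) (hbm : Measurable b)
    (hb : ∀ ζ, 0 < b ζ) (hW : ∀ ζ, 0 < W ζ) (hWi : Integrable W ν) :
    Tendsto (scaleMixture ν ε W b) atTop (𝓝 0) := by
  have hlim : Tendsto (scaleMixture ν ε W b) atTop (𝓝 (∫ _, (0 : ℝ) ∂ν)) := by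
    refine tendsto_integral_filter_of_dominated_convergence W ?_ ?_ hWi ?_
    · exact Eventually.of_forall fun z => ((measurable_scaleMixture_integrand hWm hbm).comp
        measurable_prodMk_left).aestronglyMeasurable
    · filter_upwards [eventually_ge_atTop 0] with z hz
      exact ae_of_all _ (norm_scaleMixture_integrand_le hε hb hW hz)
    · refine ae_of_all _ fun ζ => ?_
      have h1 : Tendsto (fun z => b ζ / (b ζ + z)) atTop (𝓝 0) :=
        tendsto_const_nhds.div_atTop (tendsto_atTop_add_const_left _ _ tendsto_id)
      have h2 := (h1.rpow_const (Or.inr hε.le)).const_mul (W ζ)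
      rwa [Real.zero_rpow hε.ne', mul_zero] at h2
  rwa [integral_zero] at hlim

theorem integral_scaleMixture [IsFiniteMeasure ν] (hε : 0 < ε) (hWm : Measurable W) (hbm : Measurable b)
    (hb : ∀ ζ, 0 < b ζ) (hW : ∀ ζ, 0 < W ζ) (hWi : Integrable W ν) {g : ℝ → ℝ}
    (hg : Measurable g) (hg0 : ∀ e, 0 ≤ g e) :
    ∫ e, scaleMixture ν ε W b (g e) ∂ν =
      ∫ ζ, W ζ * ∫ e, (b ζ / (b ζ + g e)) ^ ε ∂ν ∂ν := by
  simp only [scaleMixture, ← integral_const_mul]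
  refine integral_integral_swap ((hWi.comp_snd ν).mono' ?_ (ae_of_all _ fun p => ?_))
  · exact ((measurable_scaleMixture_integrand hWm hbm).comp
      ((hg.comp measurable_fst).prodMk measurable_snd)).aestronglyMeasurable
  · exact norm_scaleMixture_integrand_le hε hb hW (hg0 p.1) p.2

/-- At a scale B comparable to s ≥ y² the power is at least 1/2 and the denominator at most 4s,
while the weight is at least s. -/
theorem one_div_eight_le_gain {ε y s B w : ℝ} (hε1 : ε ≤ 1) (hs : 0 < s)
    (hys : y ^ 2 ≤ s) (hsB : s ≤ B) (hB : B ≤ 2 * s) (hw : s ≤ w) :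
    1 / 8 ≤ w * ((B / (B + y ^ 2)) ^ ε / (B + y ^ 2)) := by
  have hB0 : 0 < B := hs.trans_le hsB
  have hd : 0 < B + y ^ 2 := by positivity
  have hhalf : 1 / 2 ≤ B / (B + y ^ 2) := by
    rw [div_le_div_iff₀ (by norm_num) hd]
    linarith
  have hle1 : B / (B + y ^ 2) ≤ 1 := (div_le_one hd).2 (by linarith [sq_nonneg y])
  have hpow : 1 / 2 ≤ (B / (B + y ^ 2)) ^ ε := by
    have h1 := Real.rpow_le_rpow_of_exponent_ge (by positivity) hle1 hε1
    rw [Real.rpow_one] at h1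
    linarith
  have h4 : B + y ^ 2 ≤ 4 * s := by linarith
  have hw0 : 0 ≤ w := hs.le.trans hw
  calc (1 : ℝ) / 8 = s * (1 / 2 / (4 * s)) := by field_simp; norm_num
    _ ≤ w * ((B / (B + y ^ 2)) ^ ε / (B + y ^ 2)) := by gcongr

/-- With G the probability of a jump longer than εy, the loss over all scales is G∫W ≤ Gk/8. The
scales with |ζ| > εy alone gain at least kG/8. -/
theorem scaleMixture_drift [IsProbabilityMeasure ν]
    (hint : Integrable (fun e => e) ν) (hsq : Integrable (fun e => e ^ 2) ν)
    (hmean : ∫ e, e ∂ν = 0) (hvar : ∫ e, e ^ 2 ∂ν = 1) (hWm : Measurable W) (hbm : Measurable b)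
    (hb : ∀ ζ, 0 < b ζ) (hW : ∀ ζ, 0 < W ζ) (hWi : Integrable W ν) {c y k : ℝ} (hε : 0 < ε)
    (hε1 : ε ≤ 1 / 100) (hεc : 126 * ε ≤ c - 1) (hk : k = ε * (c - 1) / 2) (hy : 0 < y)
    (hcy : c ≤ ε ^ 2 * y ^ 2) (hcy' : 2 * (1 + 1 / ε) * c ^ 2 ≤ ε * y ^ 2)
    (htail : ∫ e, {e : ℝ | ε * y < |e|}.indicator (fun e => e ^ 2) e ∂ν ≤ ε ^ 2)
    (hWv : ∫ ζ, W ζ ∂ν ≤ k / 8)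
    (hgain : ∀ ζ, ε * y < |ζ| → 1 / 8 ≤ W ζ * ((b ζ / (b ζ + y ^ 2)) ^ ε / (b ζ + y ^ 2))) :
    ∫ e, scaleMixture ν ε W b ((y - e) ^ 2 + c) ∂ν ≤ scaleMixture ν ε W b (y ^ 2) := by
  have hc : 0 < c := by linarith
  have hk0 : 0 < k := by
    have : 0 < c - 1 := by linarith
    rw [hk]
    positivity
  rw [integral_scaleMixture hε hWm hbm hb hW hWi (by fun_prop) fun e => by positivity]
  have hfi := integrable_scaleMixture_integrand (ν := ν) hε hWm hbm hb hW hWi (sq_nonneg y)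
  have hS : MeasurableSet {e : ℝ | ε * y < |e|} :=
    measurableSet_lt measurable_const measurable_id.abs
  have hinner := fun ζ => integral_div_add_rpow_le hint hsq hmean hvar hε hε1 hεc hy (hb ζ) hcy
    hcy' htail
  set J : ℝ → ℝ := {e : ℝ | ε * y < |e|}.indicator (fun _ => (1 : ℝ)) with hJ
  set G := ∫ e, J e ∂ν with hG_def
  have hG0 : 0 ≤ G := integral_nonneg fun e => Set.indicator_nonneg (fun _ _ => zero_le_one) e
  have hi1 : Integrable J ν := (integrable_const 1).indicator hS
  have hi2 := hfi.sub (hi1.const_mul (k / 8))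
  have hi3 := hWi.const_mul G
  have hpt : ∀ ζ, W ζ * ∫ e, (b ζ / (b ζ + ((y - e) ^ 2 + c))) ^ ε ∂ν ≤
      W ζ * (b ζ / (b ζ + y ^ 2)) ^ ε - k / 8 * J ζ + G * W ζ := by
    intro ζ
    have h1 := mul_le_mul_of_nonneg_left (hinner ζ) (hW ζ).le
    have h2 : 1 / 8 * J ζ ≤ W ζ * ((b ζ / (b ζ + y ^ 2)) ^ ε / (b ζ + y ^ 2)) := by
      by_cases hζ : ε * y < |ζ|
      · rw [hJ, Set.indicator_of_mem (by exact hζ), mul_one]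
        exact hgain ζ hζ
      · rw [hJ, Set.indicator_of_notMem (by exact hζ), mul_zero]
        have := (hW ζ).le
        have := hb ζ
        positivity
    have h3 := mul_le_mul_of_nonneg_left h2 hk0.le
    rw [← hk] at h1
    linarith
  refine (integral_mono_of_nonneg (ae_of_all _ fun ζ => ?_) (hi2.add hi3) (ae_of_all _ hpt)).trans ?_
  · have := hb ζ
    exact mul_nonneg (hW ζ).le (integral_nonneg fun e => by positivity)
  · have h1 := integral_add hi2 hi3
    have h2 := integral_sub hfi (hi1.const_mul (k / 8))
    simp only [Pi.add_apply, Pi.sub_apply] at h1 h2 ⊢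
    rw [h1, h2, integral_const_mul, integral_const_mul, ← hG_def, scaleMixture]
    have h3 : G * ∫ ζ, W ζ ∂ν ≤ G * (k / 8) := by gcongr
    linarith

/-- A bounded Lyapunov function for transience, with scales weighted by the tail of the step
distribution so as to absorb the long jumps back towards the origin. -/
theorem exists_bounded_drift [IsProbabilityMeasure ν]
    (hint : Integrable (fun e => e) ν) (hsq : Integrable (fun e => e ^ 2) ν)
    (hmean : ∫ e, e ∂ν = 0) (hvar : ∫ e, e ^ 2 ∂ν = 1) {c : ℝ} (hc1 : 1 < c) :
    ∃ φ : ℝ → ℝ, Measurable φ ∧ (∀ z, 0 ≤ z → 0 < φ z) ∧ AntitoneOn φ (Set.Ici 0) ∧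
      Tendsto φ atTop (𝓝 0) ∧
      ∃ R : ℝ, 0 ≤ R ∧ ∀ y, R ≤ y → ∫ e, φ ((y - e) ^ 2 + c) ∂ν ≤ φ (y ^ 2) := by
  obtain ⟨ε, hε, hε1, hεc⟩ : ∃ ε : ℝ, 0 < ε ∧ ε ≤ 1 / 100 ∧ 126 * ε ≤ c - 1 := by
    refine ⟨min (1 / 100) ((c - 1) / 126), lt_min (by norm_num) (by linarith), min_le_left _ _, ?_⟩
    linarith [min_le_right (1 / 100) ((c - 1) / 126)]
  obtain ⟨k, hk_def⟩ : ∃ k, k = ε * (c - 1) / 2 := ⟨_, rfl⟩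
  have hk : 0 < k := by
    have : 0 < c - 1 := by linarith
    rw [hk_def]
    positivity
  -- The first bound serves the drift at each scale; the second keeps the tail part of ∫W below
  -- k/16.
  obtain ⟨r₀, hr₀⟩ := exists_setIntegral_sq_tail_le hsq (δ := min (ε ^ 2) (ε ^ 2 * (k / 16)))
    (by positivity)
  obtain ⟨R, hR1, hRr, hRc, hRc'⟩ : ∃ R : ℝ, 1 ≤ R ∧ r₀ ≤ ε * R ∧ c ≤ ε ^ 2 * R ^ 2 ∧
      2 * (1 + 1 / ε) * c ^ 2 ≤ ε * R ^ 2 := by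
    have hlin : Tendsto (fun R : ℝ => ε * R) atTop atTop := tendsto_id.const_mul_atTop hε
    have hp : Tendsto (fun R : ℝ => R ^ 2) atTop atTop := tendsto_pow_atTop two_ne_zero
    exact ((eventually_ge_atTop 1).and ((hlin.eventually_ge_atTop _).and
      (((hp.const_mul_atTop (by positivity : 0 < ε ^ 2)).eventually_ge_atTop _).and
      ((hp.const_mul_atTop hε).eventually_ge_atTop _)))).exists
  have hR0 : 0 < R := by linarith
  have hSm : MeasurableSet {e : ℝ | ε * R < |e|} :=
    measurableSet_lt measurable_const measurable_id.abs
  obtain ⟨b, hb_def⟩ : ∃ b : ℝ → ℝ, b = fun ζ => R ^ 2 + ζ ^ 2 / ε ^ 2 := ⟨_, rfl⟩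
  have hb : ∀ ζ, R ^ 2 ≤ b ζ := fun ζ => by
    have : 0 ≤ ζ ^ 2 / ε ^ 2 := by positivity
    rw [hb_def]
    linarith
  have hbm : Measurable b := by
    rw [hb_def]
    fun_prop
  obtain ⟨T, hT_def⟩ : ∃ T, T = {e : ℝ | ε * R < |e|}.indicator fun e => e ^ 2 := ⟨_, rfl⟩
  have hTm : Measurable T := hT_def ▸ (measurable_id.pow_const 2).indicator hSm
  have hT0 : ∀ ζ, 0 ≤ T ζ := fun ζ => hT_def ▸ Set.indicator_nonneg (fun _ _ => sq_nonneg _) ζ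
  have hTi : Integrable T ν := hT_def ▸ hsq.indicator hSm
  -- The constant k/16 keeps the mixture strictly positive; the tail term supplies the gain.
  obtain ⟨W, hW_def⟩ : ∃ W : ℝ → ℝ, W = fun ζ => k / 16 + 1 / ε ^ 2 * T ζ := ⟨_, rfl⟩
  have hWm : Measurable W := hW_def ▸ measurable_const.add (hTm.const_mul _)
  have hW0 : ∀ ζ, k / 16 ≤ W ζ := fun ζ => by
    have : 0 ≤ 1 / ε ^ 2 * T ζ := mul_nonneg (by positivity) (hT0 ζ)
    rw [hW_def]
    linarith
  have hWi : Integrable W ν := hW_def ▸ (integrable_const _).add (hTi.const_mul _)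
  have hWv : ∫ ζ, W ζ ∂ν ≤ k / 8 := by
    have h1 : ∫ ζ, W ζ ∂ν = k / 16 + 1 / ε ^ 2 * ∫ ζ, T ζ ∂ν := by
      rw [hW_def, integral_add (integrable_const _) (hTi.const_mul _), integral_const_mul]
      simp
    have h2 : ∫ ζ, T ζ ∂ν ≤ ε ^ 2 * (k / 16) := hT_def ▸ (hr₀ _ hRr).trans (min_le_right _ _)
    have h3 : 1 / ε ^ 2 * ∫ ζ, T ζ ∂ν ≤ 1 / ε ^ 2 * (ε ^ 2 * (k / 16)) := by gcongr
    have h4 : 1 / ε ^ 2 * (ε ^ 2 * (k / 16)) = k / 16 := by field_simp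
    linarith
  have hb' : ∀ ζ, 0 < b ζ := fun ζ => lt_of_lt_of_le (by positivity) (hb ζ)
  have hW' : ∀ ζ, 0 < W ζ := fun ζ => lt_of_lt_of_le (by positivity) (hW0 ζ)
  refine ⟨scaleMixture ν ε W b, measurable_scaleMixture hWm hbm, fun z hz =>
    scaleMixture_pos hε hWm hbm (by positivity : 0 < R ^ 2) (by positivity : 0 < k / 16) hb hW0
      hWi hz, antitoneOn_scaleMixture hε hWm hbm hb' hW' hWi,
    tendsto_scaleMixture hε hWm hbm hb' hW' hWi, R, hR0.le, fun y hy => ?_⟩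
  have hRy : R ^ 2 ≤ y ^ 2 := by gcongr
  refine scaleMixture_drift hint hsq hmean hvar hWm hbm hb' hW' hWi hε hε1 hεc hk_def
    (hR0.trans_le hy) (hRc.trans (by gcongr)) (hRc'.trans (by gcongr))
    ((hr₀ _ (hRr.trans (by gcongr))).trans (min_le_left _ _)) hWv fun ζ hζ => ?_
  have hζ' : ε * R < |ζ| := lt_of_le_of_lt (by gcongr) hζ
  have hys : y ^ 2 ≤ ζ ^ 2 / ε ^ 2 := by
    rw [le_div_iff₀ (by positivity), ← sq_abs ζ, mul_comm, ← mul_pow]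
    have : 0 ≤ y := hR0.le.trans hy
    gcongr
  refine one_div_eight_le_gain (by linarith) (lt_of_lt_of_le (by positivity) (hRy.trans hys)) hys
    ?_ ?_ ?_
  · rw [hb_def]
    linarith [sq_nonneg R]
  · rw [hb_def]
    linarith
  · rw [hW_def, hT_def]
    simp only
    rw [Set.indicator_of_mem (by exact hζ'), div_eq_mul_one_div, mul_comm]
    linarith

end Supercritical

/-! ### Nondegeneracy and moments of the steps, and the three regimes -/

/-- Otherwise the law lives on [0, ∞), and mean zero forces it to be concentrated at 0. -/
theorem exists_measure_Iio_neg_ne_zero {ν : Measure ℝ} (hint : Integrable (fun e => e) ν)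
    (hmean : ∫ e, e ∂ν = 0) (hvar : ∫ e, e ^ 2 ∂ν ≠ 0) :
    ∃ u : ℝ, 0 < u ∧ ν (Set.Iio (-u)) ≠ 0 := by
  by_contra! h
  have hnull : ν (Set.Iio 0) = 0 := by
    have hU : Set.Iio (0 : ℝ) = ⋃ n : ℕ, Set.Iio (-(1 / ((n : ℝ) + 1))) := by
      ext e
      simp only [Set.mem_Iio, Set.mem_iUnion]
      constructor
      · intro he
        obtain ⟨n, hn⟩ := exists_nat_one_div_lt (neg_pos.2 he)
        exact ⟨n, by linarith⟩
      · rintro ⟨n, hn⟩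
        have : (0 : ℝ) < 1 / ((n : ℝ) + 1) := by positivity
        linarith
    rw [hU, measure_iUnion_null_iff]
    exact fun n => h _ (by positivity)
  have hnn : 0 ≤ᵐ[ν] fun e => e := by
    rw [Filter.EventuallyLE, ae_iff]
    simpa [Set.Iio] using hnull
  have h0 := (integral_eq_zero_iff_of_nonneg_ae hnn hint).1 hmean
  refine hvar (integral_eq_zero_of_ae ?_)
  filter_upwards [h0] with e he
  simp [show e = 0 from he]

theorem integrable_one_add_abs_pow {ν : Measure ℝ} [IsProbabilityMeasure ν]
    (h : HasPosMgfRadius ν fun e => e) (n : ℕ) : Integrable (fun e => (1 + |e|) ^ (2 * n)) ν := by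
  obtain ⟨ρ, hρ, hexp⟩ := h
  have hmem : (0 : ℝ) ∈ interior (integrableExpSet (fun e => e) ν) := by
    rw [mem_interior]
    refine ⟨Metric.ball 0 ρ, fun t ht => ?_, Metric.isOpen_ball, Metric.mem_ball_self hρ⟩
    exact hexp t (by simpa using ht)
  have hp := integrable_pow_of_mem_interior_integrableExpSet hmem (2 * n)
  refine (((integrable_const (μ := ν) (1 : ℝ)).add hp).const_mul (2 ^ (2 * n - 1))).mono'
    (by fun_prop) (ae_of_all _ fun e => ?_)
  rw [Real.norm_of_nonneg (by positivity)]
  have h1 := add_pow_le (zero_le_one) (abs_nonneg e) (2 * n)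
  rwa [one_pow, Even.pow_abs (even_two_mul n)] at h1

theorem theorem4 {Ω : Type*} [MeasurableSpace Ω] (P : MeasureTheory.Measure Ω)
    [MeasureTheory.IsProbabilityMeasure P] (κ : ℝ) (hκ : 0 < κ)
    (X : ℕ → Ω → ℝ) (hmeas : ∀ n, Measurable (X n))
    (hindep : ProbabilityTheory.iIndepFun X P)
    (hident : ∀ n, ProbabilityTheory.IdentDistrib (X n) (X 0) P P)
    (hL2 : ∀ n, MeasureTheory.MemLp (X n) 2 P)
    (hmean : ∀ n, ∫ ω, X n ω ∂P = 0)
    (hvar : ∀ n, ProbabilityTheory.variance (X n) P = κ)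
    (X' : ℕ → Ω → ℝ) (hX' : ∀ n ω, X' n ω = X n ω / Real.sqrt κ)
    (Y : ℝ → ℕ → Ω → ℝ) (hY : ∀ x m ω, Y x m ω = besselChain κ (fun n => X' n ω) x m) :
    (κ < 4 → IsTransientChain P Y) ∧
    (4 < κ → IsRecurrentChain P Y) ∧
    (κ = 4 → HasPosMgfRadius P (X' 1) → IsRecurrentChain P Y) := by
  have hs : 0 < √κ := Real.sqrt_pos.2 hκ
  have hX'eq : ∀ n, X' n = fun ω => X n ω / √κ := fun n => funext (hX' n)
  have hm : ∀ n, Measurable (X' n) := fun n => by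
    rw [hX'eq]
    exact (hmeas n).div_const _
  have hdiv : Measurable fun t : ℝ => t / √κ := by fun_prop
  have hind : iIndepFun X' P := by
    have h := hindep.comp (fun _ t => t / √κ) fun _ => hdiv
    convert h using 1
    exact funext hX'eq
  obtain ⟨ν, hν_def⟩ : ∃ ν, ν = P.map (X' 0) := ⟨_, rfl⟩
  have hν : ∀ n, P.map (X' n) = ν := fun n => by
    have h := ((hident n).comp hdiv).map_eq
    rw [hν_def, hX'eq, hX'eq]
    exact h
  have hprob : IsProbabilityMeasure ν :=
    hν_def ▸ Measure.isProbabilityMeasure_map (hm 0).aemeasurable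
  have hint' : ∀ n, Integrable (X' n) P := fun n => by
    rw [hX'eq]
    exact ((hL2 n).integrable one_le_two).div_const _
  have hsq' : ∀ n, Integrable (fun ω => X' n ω ^ 2) P := fun n => by
    simp only [hX', div_pow]
    exact (hL2 n).integrable_sq.div_const _
  have hint : Integrable (fun e => e) ν := by
    rw [hν_def, integrable_map_measure (by fun_prop) (hm 0).aemeasurable]
    exact hint' 0
  have hsq : Integrable (fun e => e ^ 2) ν := by
    rw [hν_def, integrable_map_measure (by fun_prop) (hm 0).aemeasurable]
    exact hsq' 0
  have hmean0 : ∫ e, e ∂ν = 0 := by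
    rw [hν_def, integral_map (hm 0).aemeasurable (by fun_prop)]
    simp only [hX', integral_div, hmean, zero_div]
  have hvar1 : ∫ e, e ^ 2 ∂ν = 1 := by
    rw [hν_def, integral_map (hm 0).aemeasurable (by fun_prop)]
    have h := hvar 0
    rw [variance_of_integral_eq_zero (hmeas 0).aemeasurable (hmean 0)] at h
    simp only [hX', div_pow, integral_div, Real.sq_sqrt hκ.le]
    rw [h, div_self hκ.ne']
  obtain ⟨u, hu, hpos⟩ := exists_measure_Iio_neg_ne_zero hint hmean0 (by rw [hvar1]; norm_num)
  have hlim := ae_frequently_lt_besselChain hκ hm hind hν hu hpos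
  have hc : 0 < 4 / κ := by positivity
  refine ⟨fun hκ4 x _ => ?_, fun hκ4 => ?_, fun hκ4 hmgf => ?_⟩
  · obtain ⟨φ, hφm, hφ0, hφa, hφl, R, hR, hd⟩ :=
      exists_bounded_drift hint hsq hmean0 hvar1 ((one_lt_div hκ).2 hκ4)
    filter_upwards [ae_tendsto_besselChain_of_drift hκ hm hind hν (hlim x) hφm hφ0 hφa hφl hR hd]
      with ω hω
    simp only [hY]
    exact tendsto_abs_atTop_atTop.comp hω
  · obtain ⟨R, hd⟩ := exists_log_drift hint hsq hmean0 hvar1 hc ((div_lt_one hκ).2 hκ4)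
    refine ⟨R, fun x _ => ?_⟩
    simp only [hY]
    refine ae_frequently_le_besselChain_of_drift hκ hm hind hν hsq' (hlim x)
      (φ := fun z => Real.log z - Real.log (4 / κ)) (by fun_prop)
      (fun z hz => sub_nonneg.2 (Real.log_le_log hc hz)) (C := -Real.log (4 / κ))
      (fun z hz => ?_) (tendsto_atTop_add_const_right _ _ Real.tendsto_log_atTop) hd
    linarith [Real.log_le_sub_one_of_pos (hc.trans_le hz)]
  · have h41 : 4 / κ = 1 := by rw [hκ4]; norm_num
    have hmgfν : HasPosMgfRadius ν fun e => e := by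
      obtain ⟨ρ, hρ, h⟩ := hmgf
      refine ⟨ρ, hρ, fun t ht => ?_⟩
      rw [← hν 1, integrable_map_measure (by fun_prop) (hm 1).aemeasurable]
      exact h t ht
    -- The value 9 gives the moment of order 18 = 2 · 9.
    obtain ⟨R, hd⟩ := exists_sqrt_log_drift hint hsq hmean0 hvar1
      (integrable_one_add_abs_pow hmgfν 9)
    refine ⟨R, fun x _ => ?_⟩
    simp only [hY]
    refine ae_frequently_le_besselChain_of_drift hκ hm hind hν hsq' (hlim x)
      (φ := fun z => √(Real.log z)) (by fun_prop) (fun z _ => Real.sqrt_nonneg _) (C := 0)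
      (fun z hz => ?_) (Real.tendsto_sqrt_atTop.comp Real.tendsto_log_atTop) (by rwa [h41])
    rw [h41] at hz
    rw [Real.sqrt_le_left (by linarith)]
    have := Real.log_le_sub_one_of_pos (by linarith : 0 < z)
    nlinarith
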